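/- Let $P=\{x\in\mathbb R^n:\langle a,x\rangle\ge -1 \text{ for all facet normals } a\in\mathbb Z^n\}$ be a reflexive Delzant polytope, and let $X$ be the toric Fano manifold with polytope $P$, polarized by $-K_X$, with open orbit $X_0=(\mathbb C^*)^n$ (every toric Fano manifold arises in this way). Put $V_P=\int_P 1$. Let $\omega_0$ be an $(S^1)^n$-invariant Kähler form on $X$ in the class $2\pi c_1(X)$, and let $\rho_0\in C^\infty(X)$ be its normalized Ricci potential, $$\mathrm{Ric}(\omega_0)-\omega_0=\sqrt{-1}\,\partial\bar\partial\rho_0,\qquad \int_X e^{\rho_0}\omega_0^n=\int_X\omega_0^n .$$ On $X_0$, with coordinates $w$ and $\xi_j=\log|w_j|^2$, write $\omega_0=\sqrt{-1}\,\partial\bar\partial\phi_0$ with $\phi_0=\phi_0(\xi)$ a smooth function on $\mathbb R^n$ whose moment map $\nabla\phi_0$ takes its values in $P$. Let $u_0(x)=\sup_{\xi\in\mathbb R^n}(\langle x,\xi\rangle-\phi_0(\xi))$, $x\in P$, be the symplectic potential, and define $\sigma_0(x)=e^{\rho_0(\xi)}$ with $\xi=\nabla u_0(x)$, for $x$ in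 the interior of $P$; here $\rho_0(\xi)$ is the value of $\rho_0$ at any point of $X_0$ with $\log|w_j|^2=\xi_j$ for all $j$. Let $\mathrm{Conv}^0(P)$ be the set of continuous convex functions on the closed polytope $P$. For $g\in L^2(P)$ and $u\in\mathrm{Conv}^0(P)$ let $\phi(\xi)=\sup_{x\in P}(\langle x,\xi\rangle-u(x))$ and $$D_g(u)=-\log\left(\int_{\mathbb R^n}e^{-(\phi-\inf_{\mathbb R^n}\phi)}\,d\xi\right)-u(0)+\frac1{V_P}\int_P u\,g .$$ Then: 1. $\sigma_0$ is a positive balancing function: $\sigma_0\in L^2(P)$, $\sigma_0\ge\varepsilon$ on the interior of $P$ for some $\varepsilon>0$, $\int_P\sigma_0=V_P$, and $\int_P\sigma_0x_i=0$ for $1\le i\le n$. 2. $u_0\in\mathrm{Conv}^0(P)$, and for every $u\in\mathrm{Conv}^0(P)$ the integral of $e^{-(\phi-\inf\phi)}$ converges and $D_{\sigma_0}(u_0)\le D_{\sigma_0}(u)$. That is, the minimum of $D_{\sigma_0}$ over $\mathrm{Conv}^0(P)$ is attained by $u_0$. -/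

import Mathlib

open MeasureTheory
open scoped ContDiff ComplexOrder ComplexConjugate Gradient RealInnerProductSpace

noncomputable section

/-! ## Complex calculus on `ℂⁿ` -/

/-- The Wirtinger derivative `∂F/∂yᵢ = ½ (∂F/∂(Re yᵢ) - √-1 ∂F/∂(Im yᵢ))`. -/
def dz {n : ℕ} (i : Fin n) (F : (Fin n → ℂ) → ℂ) (y : Fin n → ℂ) : ℂ :=
  (1 / 2 : ℂ) *
    (fderiv ℝ F y (Pi.single i 1) - Complex.I * fderiv ℝ F y (Pi.single i Complex.I))

/-- The Wirtinger derivative `∂F/∂ȳᵢ = ½ (∂F/∂(Re yᵢ) + √-1 ∂F/∂(Im yᵢ))`. -/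
def dzbar {n : ℕ} (i : Fin n) (F : (Fin n → ℂ) → ℂ) (y : Fin n → ℂ) : ℂ :=
  (1 / 2 : ℂ) *
    (fderiv ℝ F y (Pi.single i 1) + Complex.I * fderiv ℝ F y (Pi.single i Complex.I))

/-- The coefficients `∂²f/∂yᵢ∂ȳⱼ` of `√-1 ∂∂̄ f = √-1 ∑ (∂²f/∂yᵢ∂ȳⱼ) dyᵢ ∧ dȳⱼ`. -/
def ddbar {n : ℕ} (f : (Fin n → ℂ) → ℝ) (y : Fin n → ℂ) : Matrix (Fin n) (Fin n) ℂ :=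
  Matrix.of fun i j => dz i (fun y' => dzbar j (fun y'' => (f y'' : ℂ)) y') y

/-! ## Smooth reflexive polytopes -/

/-- The pairing between the lattice `N = ℤⁿ` and `ℝⁿ`, the dual of `N ⊗ ℝ`. -/
def latticePairing {n : ℕ} (a : Fin n → ℤ) (x : EuclideanSpace ℝ (Fin n)) : ℝ :=
  ∑ i, (a i : ℝ) * x i

/-- A reflexive Delzant polytope `P = {x ∈ ℝⁿ : ⟨a, x⟩ ≥ -1 for every inner facet normal a}`:
it is bounded, every inequality is attained, and at each vertex the active normals form a
`ℤ`-basis of `ℤⁿ`. (Hence all vertices are lattice points.) -/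
structure FanoPolytope (n : ℕ) where
  /-- the primitive inner normals of the facets -/
  normals : Finset (Fin n → ℤ)
  bounded : Bornology.IsBounded
    {x : EuclideanSpace ℝ (Fin n) | ∀ a ∈ normals, -1 ≤ latticePairing a x}
  attained : ∀ a ∈ normals, ∃ x : EuclideanSpace ℝ (Fin n),
    (∀ a' ∈ normals, -1 ≤ latticePairing a' x) ∧ latticePairing a x = -1
  delzant : ∀ v ∈ Set.extremePoints ℝ
      {x : EuclideanSpace ℝ (Fin n) | ∀ a ∈ normals, -1 ≤ latticePairing a x},
    ∃ b : Module.Basis (Fin n) ℤ (Fin n → ℤ),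
      Set.range b = {a | a ∈ normals ∧ latticePairing a v = -1}

namespace FanoPolytope

variable {n : ℕ} (P : FanoPolytope n)

/-- The (closed) polytope as a subset of `ℝⁿ`. -/
def body : Set (EuclideanSpace ℝ (Fin n)) :=
  {x | ∀ a ∈ P.normals, -1 ≤ latticePairing a x}

/-- The volume `V_P` of the polytope. -/
def vol : ℝ := ∫ _ in P.body, (1 : ℝ)

/-! ## The toric Fano manifold of a polytope -/

/-- The affine charts `≅ ℂⁿ` of the toric manifold: one for each vertex of `P` together with an
ordering of the facet normals at it, that is, for each ordered basis of a maximal cone of the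
normal fan. -/
def Chart : Type :=
  {b : Module.Basis (Fin n) ℤ (Fin n → ℤ) //
    ∃ v ∈ Set.extremePoints ℝ P.body, Set.range b = {a | a ∈ P.normals ∧ latticePairing a v = -1}}

theorem chart_nonempty : Nonempty P.Chart := by
  have hclosed : IsClosed P.body := by
    have : P.body = ⋂ a ∈ P.normals,
        {x : EuclideanSpace ℝ (Fin n) | -1 ≤ latticePairing a x} := by
      ext x; simp [body]
    rw [this]
    refine isClosed_biInter fun a _ => isClosed_le continuous_const ?_
    unfold latticePairing
    fun_prop
  have hcomp : IsCompact P.body := Metric.isCompact_of_isClosed_isBounded hclosed P.bounded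
  have hne : P.body.Nonempty := ⟨0, fun a _ => by simp [latticePairing]⟩
  obtain ⟨v, hv⟩ := hcomp.extremePoints_nonempty hne
  obtain ⟨b, hb⟩ := P.delzant v hv
  exact ⟨⟨b, v, hv, hb⟩⟩

/-- The anticanonical section given by a lattice point `m ∈ P`, in the chart with basis `b`:
the monomial `∏ yᵢ ^ (⟨bᵢ, m⟩ + 1)`; the exponents are `≥ 0` because `m ∈ P`. -/
def sectionInChart {P : FanoPolytope n} (b : P.Chart) (y : Fin n → ℂ) (m : Fin n → ℤ) : ℂ :=
  ∏ i, y i ^ ((∑ k, b.1 i k * m k) + 1).toNat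

/-- The gluing of the affine charts: points of two charts are identified when all sections of
`-K_X` given by lattice points of `P` take proportional values at them (the
anticanonical bundle of a toric Fano manifold is very ample). -/
def gluing : Setoid (P.Chart × (Fin n → ℂ)) where
  r p q := ∃ c : ℂ, c ≠ 0 ∧ ∀ m : Fin n → ℤ, WithLp.toLp 2 (fun k => (m k : ℝ)) ∈ P.body →
    sectionInChart p.1 p.2 m = c * sectionInChart q.1 q.2 m
  iseqv :=
    { refl := fun _ => ⟨1, one_ne_zero, fun _ _ => (one_mul _).symm⟩
      symm := by
        rintro p q ⟨c, hc, h⟩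
        exact ⟨c⁻¹, inv_ne_zero hc, fun m hm => by rw [h m hm, inv_mul_cancel_left₀ hc]⟩
      trans := by
        rintro p q r ⟨c, hc, h⟩ ⟨d, hd, h'⟩
        exact ⟨c * d, mul_ne_zero hc hd, fun m hm => by rw [h m hm, h' m hm, mul_assoc]⟩ }

/-- The toric Fano manifold `X` with polytope `P`, as the set glued from its affine charts. -/
def X : Type := Quotient P.gluing

variable {P}

/-- The parametrization `ℂⁿ → X` of the affine chart `b`. -/
def Chart.point (b : P.Chart) (y : Fin n → ℂ) : P.X := Quotient.mk P.gluing (b, y)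

/-- The change of coordinates on the open orbit `X₀ = (ℂˣ)ⁿ`, from the coordinates `y` of the
chart `b` to the coordinates `w`: `w_j = ∏ yᵢ ^ (bᵢ)_j`. -/
def Chart.toTorus (b : P.Chart) (y : Fin n → ℂ) : Fin n → ℂ :=
  fun j => ∏ i, y i ^ (b.1 i j)

/-- The inverse change of coordinates on the open orbit: `yᵢ = ∏ w_j ^ (b*ᵢ)_j`, with `b*` the
basis dual to `b`. -/
def Chart.ofTorus (b : P.Chart) (w : Fin n → ℂ) : Fin n → ℂ :=
  fun i => ∏ j, w j ^ (b.1.repr (Pi.single j 1) i)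

variable (P)

/-- The point of `X₀ = (ℂˣ)ⁿ ⊆ X` with coordinates `w` (all nonzero). It does not depend on the
chart through which it is written. -/
def torusPoint (w : Fin n → ℂ) : P.X :=
  let b : P.Chart := Classical.choice P.chart_nonempty
  b.point (b.ofTorus w)

/-- A function on `X` is smooth when it is so in all charts. -/
def SmoothFunction (f : P.X → ℝ) : Prop :=
  ∀ b : P.Chart, ContDiff ℝ ∞ fun y => f (b.point y)

/-! ## Invariant Kähler metrics -/

/-- An `(S¹)ⁿ`-invariant Kähler form `ω` on `X`. -/
structure InvariantKahlerMetric where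
  /-- in the chart `b`, `ω = √-1 ∑ (coeff b y)ᵢⱼ dyᵢ ∧ dȳⱼ` -/
  coeff : P.Chart → (Fin n → ℂ) → Matrix (Fin n) (Fin n) ℂ
  /-- on `X₀`, `ω = √-1 ∑ (torusCoeff w)ₖₗ (dwₖ / wₖ) ∧ (dw̄ₗ / w̄ₗ)` -/
  torusCoeff : (Fin n → ℂ) → Matrix (Fin n) (Fin n) ℂ
  /-- the expressions agree on `X₀`, where `dwₖ / wₖ = ∑ (bᵢ)ₖ dyᵢ / yᵢ` -/
  compatible : ∀ (b : P.Chart) (y : Fin n → ℂ), (∀ i, y i ≠ 0) → ∀ i j,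
    y i * coeff b y i j * conj (y j) =
      ∑ k, ∑ l, (b.1 i k : ℂ) * torusCoeff (b.toTorus y) k l * (b.1 j l : ℂ)
  smooth : ∀ b i j, ContDiff ℝ ∞ fun y => coeff b y i j
  posDef : ∀ b y, (coeff b y).PosDef
  /-- `∂ω = 0`; `∂̄ω = 0` is the conjugate equation -/
  closed : ∀ b y i j k,
    dz k (fun y' => coeff b y' i j) y = dz i (fun y' => coeff b y' k j) y
  invariant : ∀ b (t y : Fin n → ℂ), (∀ i, ‖t i‖ = 1) → ∀ i j,
    t i * coeff b (t * y) i j * conj (t j) = coeff b y i j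

namespace InvariantKahlerMetric

variable {P} (g : P.InvariantKahlerMetric)

/-- `∫_X f ωⁿ`, with `ω` the Kähler form of `g`, computed in the chart `b`, whose complement in `X` is a null set;
`ωⁿ = n! 2ⁿ det(coeff) dλ`. -/
def integral (b : P.Chart) (f : P.X → ℝ) : ℝ :=
  ∫ y : Fin n → ℂ, f (b.point y) * ((n.factorial : ℝ) * 2 ^ n * (g.coeff b y).det.re)

/-- `ρ` is the normalized Ricci potential of the Kähler form `ω` of `g`: a smooth function on `X` with
`Ric(ω) - ω = √-1 ∂∂̄ ρ`, where `Ric(ω) = -√-1 ∂∂̄ log det`, and `∫_X e^ρ ωⁿ = ∫_X ωⁿ`.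
In particular `ω` lies in the class `2π c₁(X)`. -/
def IsNormalizedRicciPotential (ρ : P.X → ℝ) : Prop :=
  P.SmoothFunction ρ ∧
  (∀ (b : P.Chart) (y : Fin n → ℂ),
    -ddbar (fun y' => Real.log (g.coeff b y').det.re) y - g.coeff b y =
      ddbar (fun y' => ρ (b.point y')) y) ∧
  ∀ b : P.Chart, g.integral b (fun p => Real.exp (ρ p)) = g.integral b (fun _ => 1)

/-- The coordinates `ξ_j = log |w_j|²` on `X₀`. -/
def _root_.logAbsSq (w : Fin n → ℂ) : EuclideanSpace ℝ (Fin n) :=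
  WithLp.toLp 2 fun j => Real.log (‖w j‖ ^ 2)

/-- `φ`, as a function of `ξ`, is a potential of the Kähler form `ω` of `g` on `X₀`, that is `ω = √-1 ∂∂̄ φ`, whose moment
map `∇φ` takes its values in `P`. (The latter fixes the linear part of `φ`.) -/
def IsPotential (φ : EuclideanSpace ℝ (Fin n) → ℝ) : Prop :=
  ContDiff ℝ ∞ φ ∧
  (∀ w : Fin n → ℂ, (∀ j, w j ≠ 0) → ∀ k l,
    w k * ddbar (fun w' => φ (logAbsSq w')) w k l * conj (w l) = g.torusCoeff w k l) ∧
  ∀ ξ, ∇ φ ξ ∈ P.body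

end InvariantKahlerMetric

/-! ## Functions on the polytope -/

/-- The symplectic potential `u(x) = sup_ξ (⟨x, ξ⟩ - φ(ξ))`, the Legendre transform of `φ`. -/
def _root_.symplecticPotential (φ : EuclideanSpace ℝ (Fin n) → ℝ)
    (x : EuclideanSpace ℝ (Fin n)) : ℝ :=
  ⨆ ξ : EuclideanSpace ℝ (Fin n), (⟪x, ξ⟫ - φ ξ)

/-- The Legendre transform `φ(ξ) = sup_{x ∈ P} (⟨x, ξ⟩ - u(x))` of a function on `P`. -/
def legendre (u : EuclideanSpace ℝ (Fin n) → ℝ) (ξ : EuclideanSpace ℝ (Fin n)) : ℝ :=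
  ⨆ x : P.body, (⟪(x : EuclideanSpace ℝ (Fin n)), ξ⟫ - u x)

/-- `e^ρ` transported to the polytope: its value at `x` is the value of `e^ρ` at a point of `X₀`
with `(log |w_j|²)_j = ξ`, namely `w = e^{ξ/2}`, where `ξ = ∇u(x)`. -/
def transported (ρ : P.X → ℝ) (u : EuclideanSpace ℝ (Fin n) → ℝ)
    (x : EuclideanSpace ℝ (Fin n)) : ℝ :=
  Real.exp (ρ (P.torusPoint fun j => (Real.exp (∇ u x j / 2) : ℂ)))

/-- Balancing functions on `P`. -/
def IsBalancing (g : EuclideanSpace ℝ (Fin n) → ℝ) : Prop :=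
  MemLp g 2 (volume.restrict P.body) ∧
  (∀ᵐ x ∂(volume.restrict P.body), 0 ≤ g x) ∧
  ∫ x in P.body, g x = P.vol ∧
  ∀ i, ∫ x in P.body, g x * x i = 0

/-- `Conv⁰(P)`: the continuous convex functions on the closed polytope. -/
def convZero : Set (EuclideanSpace ℝ (Fin n) → ℝ) :=
  {u | ContinuousOn u P.body ∧ ConvexOn ℝ P.body u}

/-- The integrand `e^{-(φ - inf φ)}`, with `φ` the Legendre transform of `u`. -/
def dingDensity (u : EuclideanSpace ℝ (Fin n) → ℝ) (ξ : EuclideanSpace ℝ (Fin n)) : ℝ :=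
  Real.exp (-(P.legendre u ξ - ⨅ η, P.legendre u η))

/-- The `g`-modified non-Archimedean Ding functional `-u(0) + (1/V_P) ∫_P u g`. -/
def dingNA (g u : EuclideanSpace ℝ (Fin n) → ℝ) : ℝ :=
  -u 0 + (1 / P.vol) * ∫ x in P.body, u x * g x

/-- The `g`-modified Ding functional
`D_g(u) = -log ∫ e^{-(φ - inf φ)} - u(0) + (1/V_P) ∫_P u g`. -/
def ding (g u : EuclideanSpace ℝ (Fin n) → ℝ) : ℝ :=
  -Real.log (∫ ξ, P.dingDensity u ξ) + P.dingNA g u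

end FanoPolytope

end

/-!
The proof turns the statement into convex analysis on `ℝⁿ` and then uses the Prékopa–Leindler
inequality.

On the open orbit, in logarithmic coordinates `w = e^z`, the metric is the real Hessian of `φ₀`, and
the Ricci potential equation says that `log det D²φ₀ + φ₀ + ρ₀` is pluriharmonic
(`ddbar_ricci_eq_zero`). Rotating the torus changes `ρ₀` by a bounded pluriharmonic function, so by
Liouville's theorem `ρ₀` is invariant (`ricciPotential_rotate`); the pluriharmonic function above
then depends on `ξ` only and is affine. Smoothness of the metric in the affine charts gives
`log det D²φ₀ = -h_P + O(1)`, with `h_P` the support function of `P`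
(`exists_bound_log_det_hessian`), while `∇φ₀ ∈ P` gives `φ₀ ≤ h_P + O(1)`. Hence the linear part is
bounded above and vanishes, which yields both the Monge–Ampère equation
`det D²φ₀ = e^{d - φ₀ - ρ₀}` (`exists_monge_ampere`) and the growth `φ₀ ≥ h_P - O(1)`
(`exists_inner_sub_potential_le`).

The growth makes `∇φ₀` a diffeomorphism onto the interior of `P`, with inverse `∇u₀`, and makes `u₀`
bounded on `P`; a bounded convex function on a polytope is upper semicontinuous, so `u₀` is
continuous up to the boundary. By the Monge–Ampère equation `∇φ₀` carries `e^{d - φ₀} dξ` to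
`σ₀ dx` (`exists_setIntegral_mul_transported`). Balancing follows: the mass is the normalization of
`ρ₀` integrated over the angles, and the barycenter is the integral of a gradient.

For `u` continuous and convex on `P`, `inf φ = -u(0)`, so
`D_σ(u) = -log ∫ e^{-φ} + V_P⁻¹ ∫_P u σ` (`ding_eq`). Along the segment `u_t = (1 - t) u₀ + t u` the
Prékopa–Leindler inequality makes `t ↦ -log ∫ e^{-φ_t}` convex, and
`φ_t(ξ) ≥ φ₀(ξ) - t (u - u₀)(∇φ₀(ξ))` bounds its derivative at `t = 0` from below by
`-V_P⁻¹ ∫_P (u - u₀) σ₀` (`log_integral_le`). This is the minimality of `u₀`.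
-/

noncomputable section

open Set Filter Topology
open scoped ENNReal NNReal

/-! ### The Prékopa–Leindler inequality -/

/-- The one-dimensional Brunn–Minkowski inequality. For compact `K ⊆ A` and `L ⊆ B`, the translates
`min L + K` and `max K + L` lie in `C` and meet in a single point. -/
theorem volume_add_volume_le_of_add_mem {A B C : Set ℝ} (hA : MeasurableSet A)
    (hB : MeasurableSet B) (hAne : A.Nonempty) (hBne : B.Nonempty)
    (h : ∀ a ∈ A, ∀ b ∈ B, a + b ∈ C) : volume A + volume B ≤ volume C := by
  have key : ∀ K ⊆ A, IsCompact K → ∀ L ⊆ B, IsCompact L → volume K + volume L ≤ volume C := by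
    intro K₀ hK₀A hK₀ L₀ hL₀B hL₀
    obtain ⟨a₀, ha₀⟩ := hAne
    obtain ⟨b₀, hb₀⟩ := hBne
    obtain ⟨K, hKA, hK, hKne, hKK⟩ : ∃ K ⊆ A, IsCompact K ∧ K.Nonempty ∧ K₀ ⊆ K :=
      ⟨insert a₀ K₀, insert_subset ha₀ hK₀A, hK₀.insert a₀, insert_nonempty _ _, subset_insert _ _⟩
    obtain ⟨L, hLB, hL, hLne, hLL⟩ : ∃ L ⊆ B, IsCompact L ∧ L.Nonempty ∧ L₀ ⊆ L :=
      ⟨insert b₀ L₀, insert_subset hb₀ hL₀B, hL₀.insert b₀, insert_nonempty _ _, subset_insert _ _⟩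
    obtain ⟨a, haK, ha⟩ := hK.exists_isGreatest hKne
    obtain ⟨b, hbL, hb⟩ := hL.exists_isLeast hLne
    have hdisj : AEDisjoint volume ((fun x => x + b) '' K) ((fun x => a + x) '' L) := by
      refine measure_mono_null (t := {a + b}) ?_ (by simp)
      rintro x ⟨⟨y, hy, rfl⟩, ⟨z, hz, hzx⟩⟩
      have h1 := ha hy
      have h2 := hb hz
      simp only [mem_singleton_iff] at *
      linarith
    calc volume K₀ + volume L₀ ≤ volume K + volume L :=
          add_le_add (measure_mono hKK) (measure_mono hLL)
      _ = volume ((fun x => x + b) '' K) + volume ((fun x => a + x) '' L) := by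
          simp [image_add_right, image_add_left]
      _ = volume (((fun x => x + b) '' K) ∪ ((fun x => a + x) '' L)) := by
          refine (measure_union₀ ?_ hdisj).symm
          exact (hL.image (continuous_const.add continuous_id)).measurableSet.nullMeasurableSet
      _ ≤ volume C := by
          refine measure_mono (union_subset ?_ ?_)
          · rintro _ ⟨y, hy, rfl⟩
            exact h y (hKA hy) b (hLB hbL)
          · rintro _ ⟨y, hy, rfl⟩
            exact h a (hKA haK) y (hLB hy)
  rw [hA.measure_eq_iSup_isCompact, hB.measure_eq_iSup_isCompact]
  simp only [iSup_and']
  exact ENNReal.biSup_add_biSup_le' ⟨∅, empty_subset _, isCompact_empty⟩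
    ⟨∅, empty_subset _, isCompact_empty⟩ fun K hK L hL => key K hK.1 hK.2 L hL.1 hL.2

theorem ENNReal.geom_mean_le_arith_mean2 {t : ℝ} (ht0 : 0 < t) (ht1 : t < 1) (a b : ℝ≥0∞) :
    a ^ (1 - t) * b ^ t ≤ ENNReal.ofReal (1 - t) * a + ENNReal.ofReal t * b := by
  have hs : 0 < 1 - t := by linarith
  rcases eq_or_ne a ⊤ with rfl | ha
  · rw [ENNReal.mul_top (by simpa using hs), top_add]
    exact le_top
  rcases eq_or_ne b ⊤ with rfl | hb
  · rw [ENNReal.mul_top (by simpa using ht0), add_top]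
    exact le_top
  lift a to ℝ≥0 using ha
  lift b to ℝ≥0 using hb
  have := NNReal.geom_mean_le_arith_mean2_weighted ⟨1 - t, hs.le⟩ ⟨t, ht0.le⟩ a b
    (NNReal.eq (sub_add_cancel 1 t))
  rw [← ENNReal.coe_rpow_of_nonneg _ hs.le, ← ENNReal.coe_rpow_of_nonneg _ ht0.le,
    ENNReal.ofReal_eq_coe_nnreal hs.le, ENNReal.ofReal_eq_coe_nnreal ht0.le]
  exact_mod_cast this

/-- The one-dimensional Prékopa–Leindler inequality for functions of supremum one, in its stronger
arithmetic form: compare superlevel sets and integrate over the level. -/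
theorem lintegral_add_le_of_iSup_eq_one {t : ℝ} (ht0 : 0 < t) (ht1 : t < 1)
    {f g h : ℝ → ℝ≥0∞} (hf : Measurable f) (hg : Measurable g) (hh : Measurable h)
    (hf1 : ⨆ x, f x = 1) (hg1 : ⨆ x, g x = 1)
    (hfgh : ∀ x y, f x ^ (1 - t) * g y ^ t ≤ h ((1 - t) * x + t * y)) :
    ENNReal.ofReal (1 - t) * (∫⁻ x, f x) + ENNReal.ofReal t * (∫⁻ x, g x) ≤ ∫⁻ x, h x := by
  have hs : 0 < 1 - t := by linarith
  have hf_le : ∀ x, f x ≤ 1 := fun x => hf1 ▸ le_iSup f x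
  have hg_le : ∀ x, g x ≤ 1 := fun x => hg1 ▸ le_iSup g x
  have layer : ∀ k : ℝ → ℝ≥0∞, Measurable k → (∀ x, k x ≤ 1) →
      ∫⁻ x, k x = ∫⁻ r in Ioi (0 : ℝ), volume {x | ENNReal.ofReal r < k x} := by
    intro k hk hk1
    have hk' : ∀ x, k x ≠ ⊤ := fun x => ((hk1 x).trans_lt ENNReal.one_lt_top).ne
    have := lintegral_eq_lintegral_meas_lt volume (f := fun x => (k x).toReal)
      (ae_of_all _ fun x => ENNReal.toReal_nonneg) hk.ennreal_toReal.aemeasurable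
    simp only [ENNReal.ofReal_toReal (hk' _)] at this
    rw [this]
    refine setLIntegral_congr_fun measurableSet_Ioi fun r hr => ?_
    congr 1
    ext x
    simp only [mem_ofPred_eq]
    rw [ENNReal.ofReal_lt_iff_lt_toReal (le_of_lt hr) (hk' x)]
  have hmin : ∫⁻ x, min (h x) 1 ≤ ∫⁻ x, h x := lintegral_mono fun x => min_le_left _ _
  refine le_trans ?_ hmin
  rw [layer f hf hf_le, layer g hg hg_le,
    layer (fun x => min (h x) 1) (hh.min measurable_const) (fun x => min_le_right _ _)]
  have hmeas : ∀ k : ℝ → ℝ≥0∞, Measurable fun r : ℝ => volume {x | ENNReal.ofReal r < k x} := by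
    intro k
    refine Antitone.measurable fun r r' hr => measure_mono fun x hx => ?_
    exact lt_of_le_of_lt (ENNReal.ofReal_le_ofReal hr) hx
  rw [← lintegral_const_mul _ (hmeas f), ← lintegral_const_mul _ (hmeas g),
    ← lintegral_add_left ((hmeas f).const_mul _)]
  refine setLIntegral_mono (hmeas _) fun r hr => ?_
  rcases le_or_gt 1 r with hr1 | hr1
  · have : ∀ k : ℝ → ℝ≥0∞, (∀ x, k x ≤ 1) → volume {x | ENNReal.ofReal r < k x} = 0 := by
      intro k hk
      convert measure_empty (μ := (volume : Measure ℝ))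
      ext x
      simp only [mem_ofPred_eq, mem_empty_iff_false, iff_false, not_lt]
      exact (hk x).trans (by simpa using ENNReal.ofReal_le_ofReal hr1)
    simp [this f hf_le, this g hg_le]
  · have hr1' : ENNReal.ofReal r < 1 := by simpa using hr1
    have hscale : ∀ (c : ℝ), 0 < c → ∀ S : Set ℝ,
        ENNReal.ofReal c * volume S = volume ((fun x => c * x) '' S) := by
      intro c hc S
      have := Measure.addHaar_image_homothety (volume : Measure ℝ) 0 c S
      have e : (AffineMap.homothety (0:ℝ) c : ℝ → ℝ) = fun x => c * x := by
        ext x; simp [AffineMap.homothety_apply]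
      rw [e] at this
      simpa [abs_of_pos hc] using this.symm
    rw [hscale _ hs, hscale _ ht0]
    have hms : ∀ (c : ℝ), 0 < c → ∀ S : Set ℝ, MeasurableSet S →
        MeasurableSet ((fun x => c * x) '' S) := by
      intro c hc S hS
      exact (Homeomorph.mulLeft₀ c hc.ne').measurableEmbedding.measurableSet_image.2 hS
    refine volume_add_volume_le_of_add_mem
      (hms _ hs _ (measurableSet_lt measurable_const hf))
      (hms _ ht0 _ (measurableSet_lt measurable_const hg)) ?_ ?_ ?_
    · obtain ⟨x, hx⟩ := lt_iSup_iff.1 (hf1.symm ▸ hr1')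
      exact ⟨_, x, hx, rfl⟩
    · obtain ⟨x, hx⟩ := lt_iSup_iff.1 (hg1.symm ▸ hr1')
      exact ⟨_, x, hx, rfl⟩
    · rintro _ ⟨x, hx, rfl⟩ _ ⟨y, hy, rfl⟩
      refine lt_min (lt_of_lt_of_le ?_ (hfgh x y)) hr1'
      have hr0 : ENNReal.ofReal r ≠ 0 := by simpa using hr
      calc ENNReal.ofReal r = ENNReal.ofReal r ^ (1 - t) * ENNReal.ofReal r ^ t := by
            rw [← ENNReal.rpow_add _ _ hr0 ENNReal.ofReal_ne_top]; simp
        _ < f x ^ (1 - t) * g y ^ t :=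
            ENNReal.mul_lt_mul (ENNReal.rpow_lt_rpow hx hs) (ENNReal.rpow_lt_rpow hy ht0)

/-- The one-dimensional Prékopa–Leindler inequality for bounded functions. -/
theorem prekopa_leindler_real_of_bounded {t : ℝ} (ht0 : 0 < t) (ht1 : t < 1)
    {f g h : ℝ → ℝ≥0∞} (hf : Measurable f) (hg : Measurable g) (hh : Measurable h)
    (hfb : ⨆ x, f x ≠ ⊤) (hgb : ⨆ x, g x ≠ ⊤)
    (hfgh : ∀ x y, f x ^ (1 - t) * g y ^ t ≤ h ((1 - t) * x + t * y)) :
    (∫⁻ x, f x) ^ (1 - t) * (∫⁻ x, g x) ^ t ≤ ∫⁻ x, h x := by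
  have hs : 0 < 1 - t := by linarith
  rcases eq_or_ne (⨆ x, f x) 0 with hF | hF
  · have : ∀ x, f x = 0 := by simpa using hF
    simp [this, ENNReal.zero_rpow_of_pos hs]
  rcases eq_or_ne (⨆ x, g x) 0 with hG | hG
  · have : ∀ x, g x = 0 := by simpa using hG
    simp [this, ENNReal.zero_rpow_of_pos ht0]
  set F := ⨆ x, f x
  set G := ⨆ x, g x
  set H := F⁻¹ ^ (1 - t) * G⁻¹ ^ t
  have hH0 : H ≠ 0 := mul_ne_zero (by simp [ENNReal.rpow_eq_zero_iff, hF, hfb])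
    (by simp [ENNReal.rpow_eq_zero_iff, hG, hgb])
  have hHt : H ≠ ⊤ := ENNReal.mul_ne_top
    (ENNReal.rpow_ne_top_of_nonneg hs.le (by simpa using hF))
    (ENNReal.rpow_ne_top_of_nonneg ht0.le (by simpa using hG))
  have key := lintegral_add_le_of_iSup_eq_one ht0 ht1 (f := fun x => F⁻¹ * f x)
    (g := fun x => G⁻¹ * g x) (h := fun x => H * h x) (hf.const_mul _) (hg.const_mul _)
    (hh.const_mul _) (by rw [← ENNReal.mul_iSup, ENNReal.inv_mul_cancel hF hfb])
    (by rw [← ENNReal.mul_iSup, ENNReal.inv_mul_cancel hG hgb]) (by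
      intro x y
      rw [ENNReal.mul_rpow_of_nonneg _ _ hs.le, ENNReal.mul_rpow_of_nonneg _ _ ht0.le,
        mul_mul_mul_comm]
      exact mul_le_mul_right (hfgh x y) _)
  have key2 := (ENNReal.geom_mean_le_arith_mean2 ht0 ht1 _ _).trans key
  rw [lintegral_const_mul _ hf, lintegral_const_mul _ hg, lintegral_const_mul _ hh,
    ENNReal.mul_rpow_of_nonneg _ _ hs.le, ENNReal.mul_rpow_of_nonneg _ _ ht0.le,
    mul_mul_mul_comm] at key2
  exact (ENNReal.mul_le_mul_iff_right hH0 hHt).1 key2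

theorem prekopa_leindler_real {t : ℝ} (ht0 : 0 < t) (ht1 : t < 1)
    {f g h : ℝ → ℝ≥0∞} (hf : Measurable f) (hg : Measurable g) (hh : Measurable h)
    (hfgh : ∀ x y, f x ^ (1 - t) * g y ^ t ≤ h ((1 - t) * x + t * y)) :
    (∫⁻ x, f x) ^ (1 - t) * (∫⁻ x, g x) ^ t ≤ ∫⁻ x, h x := by
  have hs : 0 < 1 - t := by linarith
  rcases eq_or_ne (∫⁻ x, f x) 0 with hF | hF
  · simp [hF, ENNReal.zero_rpow_of_pos hs]
  rcases eq_or_ne (∫⁻ x, g x) 0 with hG | hG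
  · simp [hG, ENNReal.zero_rpow_of_pos ht0]
  have lim : ∀ k : ℝ → ℝ≥0∞, Measurable k →
      Tendsto (fun N : ℕ => ∫⁻ x, min (k x) N) atTop (𝓝 (∫⁻ x, k x)) := by
    intro k hk
    refine lintegral_tendsto_of_tendsto_of_monotone
      (fun N => (hk.min measurable_const).aemeasurable)
      (ae_of_all _ fun x N M hNM => min_le_min_left _ (by exact_mod_cast hNM))
      (ae_of_all _ fun x => ?_)
    have := (tendsto_const_nhds (x := k x)).min ENNReal.tendsto_nat_nhds_top
    simpa using this
  have lim' := ENNReal.Tendsto.mul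
    ((ENNReal.continuous_rpow_const (y := 1 - t)).continuousAt.tendsto.comp (lim f hf))
    (Or.inl (by simp [ENNReal.rpow_eq_zero_iff, hF, ht1.le]))
    ((ENNReal.continuous_rpow_const (y := t)).continuousAt.tendsto.comp (lim g hg))
    (Or.inl (by simp [ENNReal.rpow_eq_zero_iff, hG, ht0.le]))
  refine le_of_tendsto' lim' fun N => ?_
  have hb : ∀ k : ℝ → ℝ≥0∞, ⨆ x, min (k x) (N : ℝ≥0∞) ≠ ⊤ := fun k =>
    ((iSup_le fun x => min_le_right _ _).trans_lt (ENNReal.natCast_lt_top N)).ne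
  refine prekopa_leindler_real_of_bounded ht0 ht1 (hf.min measurable_const)
    (hg.min measurable_const) hh (hb f) (hb g) fun x y => le_trans ?_ (hfgh x y)
  exact mul_le_mul' (ENNReal.rpow_le_rpow (min_le_left _ _) hs.le)
    (ENNReal.rpow_le_rpow (min_le_left _ _) ht0.le)

/-- The Prékopa–Leindler inequality, by induction on the dimension: the marginals of `f`, `g`, `h`
in the first coordinate satisfy the one-dimensional hypothesis. -/
theorem prekopa_leindler_pi {t : ℝ} (ht0 : 0 < t) (ht1 : t < 1) {n : ℕ}
    {f g h : (Fin n → ℝ) → ℝ≥0∞} (hf : Measurable f) (hg : Measurable g) (hh : Measurable h)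
    (hfgh : ∀ x y, f x ^ (1 - t) * g y ^ t ≤ h ((1 - t) • x + t • y)) :
    (∫⁻ x, f x) ^ (1 - t) * (∫⁻ x, g x) ^ t ≤ ∫⁻ x, h x := by
  induction n with
  | zero =>
    have hp : (volume : Measure (Fin 0 → ℝ)) univ = 1 := by simp [volume_pi]
    rw [lintegral_unique, lintegral_unique, lintegral_unique, hp, mul_one, mul_one, mul_one]
    convert hfgh default default
  | succ n ih =>
    have fub : ∀ k : (Fin (n + 1) → ℝ) → ℝ≥0∞, Measurable k →
        Measurable (fun a : ℝ => ∫⁻ x : Fin n → ℝ, k (Fin.cons a x)) ∧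
        (∀ a : ℝ, Measurable fun x : Fin n → ℝ => k (Fin.cons a x)) ∧
        ∫⁻ x, k x = ∫⁻ a : ℝ, ∫⁻ x : Fin n → ℝ, k (Fin.cons a x) := by
      intro k hk
      have e := (volume_preserving_piFinSuccAbove (fun _ : Fin (n + 1) => ℝ) 0).symm
      have he : ∀ p : ℝ × (Fin n → ℝ),
          (MeasurableEquiv.piFinSuccAbove (fun _ : Fin (n + 1) => ℝ) 0).symm p =
            Fin.cons p.1 p.2 := fun p => by
        simp [MeasurableEquiv.piFinSuccAbove_symm_apply, Fin.insertNthEquiv]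
      have hE : Measurable fun p : ℝ × (Fin n → ℝ) => k (Fin.cons p.1 p.2) := by
        simp only [← he]
        exact hk.comp (MeasurableEquiv.measurable _)
      refine ⟨hE.lintegral_prod_right', fun a => hE.comp measurable_prodMk_left, ?_⟩
      rw [← e.lintegral_comp hk, Measure.volume_eq_prod]
      simp only [he]
      exact lintegral_prod _ hE.aemeasurable
    obtain ⟨f1, f2, f3⟩ := fub f hf
    obtain ⟨g1, g2, g3⟩ := fub g hg
    obtain ⟨h1, h2, h3⟩ := fub h hh
    rw [f3, g3, h3]
    refine prekopa_leindler_real ht0 ht1 f1 g1 h1 fun a b => ?_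
    refine ih (f2 a) (g2 b) (h2 _) fun x y => (hfgh _ _).trans_eq ?_
    congr 1
    ext i
    refine Fin.cases ?_ (fun j => ?_) i <;> simp

/-- The Prékopa–Leindler inequality on Euclidean space. -/
theorem prekopa_leindler {t : ℝ} (ht0 : 0 < t) (ht1 : t < 1) {n : ℕ}
    {f g h : EuclideanSpace ℝ (Fin n) → ℝ≥0∞} (hf : Measurable f) (hg : Measurable g)
    (hh : Measurable h) (hfgh : ∀ x y, f x ^ (1 - t) * g y ^ t ≤ h ((1 - t) • x + t • y)) :
    (∫⁻ x, f x) ^ (1 - t) * (∫⁻ x, g x) ^ t ≤ ∫⁻ x, h x := by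
  have e := PiLp.volume_preserving_toLp (Fin n)
  rw [← e.lintegral_comp hf, ← e.lintegral_comp hg, ← e.lintegral_comp hh]
  exact prekopa_leindler_pi ht0 ht1 (hf.comp e.measurable) (hg.comp e.measurable)
    (hh.comp e.measurable) fun x y => hfgh _ _

/-! ### Second derivatives and the complex Hessian -/

section SecondDerivative

variable {V W : Type*} [NormedAddCommGroup V] [NormedSpace ℝ V] [NormedAddCommGroup W]
  [NormedSpace ℝ W]

theorem ContDiffAt.hasFDerivAt_fderiv {f : V → ℝ} {x : V} (hf : ContDiffAt ℝ 2 f x) :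
    HasFDerivAt (fderiv ℝ f) (fderiv ℝ (fderiv ℝ f) x) x :=
  ((hf.fderiv_right (m := 1) (by norm_num)).differentiableAt (by norm_num)).hasFDerivAt

theorem ContDiffAt.eventually_differentiableAt {f : V → ℝ} {x : V} (hf : ContDiffAt ℝ 2 f x) :
    ∀ᶠ y in 𝓝 x, DifferentiableAt ℝ f y := by
  filter_upwards [hf.eventually (by simp)] with y hy using hy.differentiableAt (by norm_num)

/-- The chain rule for second derivatives, with `E'' = d(E' v)`. -/
theorem fderiv_fderiv_comp {f : W → ℝ} {E : V → W} {E' : V → V →L[ℝ] W} {E'' : V →L[ℝ] W}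
    {z u v : V} (hE : ContDiff ℝ 2 E) (hf : ContDiffAt ℝ 2 f (E z))
    (hE' : ∀ y, HasFDerivAt E (E' y) y) (hE'' : HasFDerivAt (fun y => E' y v) E'' z) :
    fderiv ℝ (fderiv ℝ (fun y => f (E y))) z u v =
      fderiv ℝ (fderiv ℝ f) (E z) (E' z u) (E' z v) + fderiv ℝ f (E z) (E'' u) := by
  have hfE : ContDiffAt ℝ 2 (fun y => f (E y)) z := hf.comp z hE.contDiffAt
  have h1 : HasFDerivAt (fun y => fderiv ℝ (fun y => f (E y)) y v)
      ((ContinuousLinearMap.apply ℝ ℝ v).comp (fderiv ℝ (fderiv ℝ (fun y => f (E y))) z)) z :=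
    (ContinuousLinearMap.apply ℝ ℝ v).hasFDerivAt.comp z hfE.hasFDerivAt_fderiv
  have h2 := (hf.hasFDerivAt_fderiv.comp z (hE' z)).clm_apply hE''
  have h3 : (fun y => fderiv ℝ (fun y => f (E y)) y v) =ᶠ[𝓝 z]
      fun y => (fderiv ℝ f ∘ E) y (E' y v) := by
    filter_upwards [(hE' z).continuousAt.eventually hf.eventually_differentiableAt] with y hy
    have hc : HasFDerivAt (fun y => f (E y)) ((fderiv ℝ f (E y)).comp (E' y)) y :=
      hy.hasFDerivAt.comp y (hE' y)
    rw [hc.fderiv]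
    rfl
  have h4 := congrArg (fun A => A u) (h1.unique (h2.congr_of_eventuallyEq h3))
  simpa [add_comm] using h4

/-- Second derivatives of the composition with an affine map. -/
theorem fderiv_fderiv_comp_affine {f : W → ℝ} (L : V →L[ℝ] W) (c : W) {z u v : V}
    (hf : ContDiffAt ℝ 2 f (c + L z)) :
    fderiv ℝ (fderiv ℝ (fun y => f (c + L y))) z u v =
      fderiv ℝ (fderiv ℝ f) (c + L z) (L u) (L v) := by
  have := fderiv_fderiv_comp (f := f) (E := fun y => c + L y) (E' := fun _ => L) (E'' := 0)
    (z := z) (u := u) (v := v) (by fun_prop) hf (fun y => L.hasFDerivAt.const_add c)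
    (hasFDerivAt_const _ _)
  simpa using this

end SecondDerivative

section ComplexHessian

variable {n : ℕ}

/-- The complex Hessian in terms of real second derivatives. -/
theorem ddbar_apply {f : (Fin n → ℂ) → ℝ} {y : Fin n → ℂ} (hf : ContDiffAt ℝ 2 f y)
    (i j : Fin n) :
    ddbar f y i j = (1 / 4 : ℂ) *
      ((fderiv ℝ (fderiv ℝ f) y (Pi.single i 1) (Pi.single j 1) : ℂ)
        + fderiv ℝ (fderiv ℝ f) y (Pi.single i Complex.I) (Pi.single j Complex.I)
        + Complex.I * (fderiv ℝ (fderiv ℝ f) y (Pi.single i 1) (Pi.single j Complex.I)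
        - fderiv ℝ (fderiv ℝ f) y (Pi.single i Complex.I) (Pi.single j 1))) := by
  have h1 : ∀ v : Fin n → ℂ, HasFDerivAt (fun y' => ((fderiv ℝ f y' v : ℝ) : ℂ))
      (Complex.ofRealCLM.comp ((ContinuousLinearMap.apply ℝ ℝ v).comp
        (fderiv ℝ (fderiv ℝ f) y))) y := fun v =>
    Complex.ofRealCLM.hasFDerivAt.comp y
      ((ContinuousLinearMap.apply ℝ ℝ v).hasFDerivAt.comp y hf.hasFDerivAt_fderiv)
  have h2 := ((h1 (Pi.single j 1)).add ((h1 (Pi.single j Complex.I)).const_mul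
    Complex.I)).const_mul (1 / 2 : ℂ)
  have h3 : (fun y' => dzbar j (fun y'' => (f y'' : ℂ)) y') =ᶠ[𝓝 y] fun y' => (1 / 2 : ℂ) *
      ((fderiv ℝ f y' (Pi.single j 1) : ℝ) +
        Complex.I * (fderiv ℝ f y' (Pi.single j Complex.I) : ℝ)) := by
    filter_upwards [hf.eventually_differentiableAt] with y' hy'
    have : HasFDerivAt (fun y'' => (f y'' : ℂ)) (Complex.ofRealCLM.comp (fderiv ℝ f y')) y' :=
      Complex.ofRealCLM.hasFDerivAt.comp y' hy'.hasFDerivAt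
    simp [dzbar, this.fderiv]
  rw [ddbar, Matrix.of_apply, dz, h3.fderiv_eq]
  erw [h2.fderiv]
  simp
  linear_combination (1 / 4 : ℂ) * (-fderiv ℝ (fderiv ℝ f) y (Pi.single i Complex.I)
    (Pi.single j Complex.I)) * Complex.I_mul_I

/-- The combination of values of a real bilinear form on `ℂ` that occurs in the complex Hessian is
sesquilinear. -/
theorem sesquilinear_part (M : ℂ →ₗ[ℝ] ℂ →ₗ[ℝ] ℝ) (c d : ℂ) :
    ((M c d : ℝ) : ℂ) + M (c * Complex.I) (d * Complex.I)
        + Complex.I * (M c (d * Complex.I) - M (c * Complex.I) d) =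
      c * conj d * ((M 1 1 : ℝ) + M Complex.I Complex.I
        + Complex.I * (M 1 Complex.I - M Complex.I 1)) := by
  have hd : ∀ e : ℂ, e = e.re • (1 : ℂ) + e.im • Complex.I := fun e => by
    simp [Complex.re_add_im]
  have hI : ∀ e : ℂ, e * Complex.I = (-e.im) • (1 : ℂ) + e.re • Complex.I := fun e => by
    apply Complex.ext <;> simp
  rw [hI c, hI d]
  have h := hd c
  have h' := hd d
  set a := c.re
  set b := c.im
  set a' := d.re
  set b' := d.im
  rw [h, h']
  simp only [map_add, map_smul, LinearMap.add_apply, LinearMap.smul_apply, smul_eq_mul]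
  simp only [Complex.real_smul, map_mul, Complex.conj_ofReal, Complex.conj_I, mul_one]
  push_cast
  ring_nf
  simp only [Complex.I_sq, Complex.I_pow_three]
  ring

/-- The complex Hessian in logarithmic coordinates: `exp` is holomorphic, so the complex Hessian
transforms as a Hermitian form. -/
theorem ddbar_comp_exp {f : (Fin n → ℂ) → ℝ} {z : Fin n → ℂ}
    (hf : ContDiffAt ℝ 2 f (fun i => Complex.exp (z i))) (i j : Fin n) :
    ddbar (fun z' : Fin n → ℂ => f fun i => Complex.exp (z' i)) z i j =
      Complex.exp (z i) * ddbar f (fun i => Complex.exp (z i)) i j * conj (Complex.exp (z j)) := by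
  set E : (Fin n → ℂ) → (Fin n → ℂ) := fun z i => Complex.exp (z i)
  have hE : ContDiff ℝ 2 E := by
    refine contDiff_pi.2 fun k => ?_
    exact (Complex.contDiff_exp (𝕜 := ℝ)).comp (contDiff_apply ℝ ℂ k)
  let E' : (Fin n → ℂ) → (Fin n → ℂ) →L[ℝ] (Fin n → ℂ) := fun z =>
    ContinuousLinearMap.pi fun k => Complex.exp (z k) • ContinuousLinearMap.proj k
  have hcomp : ∀ y k, HasFDerivAt (fun z : Fin n → ℂ => Complex.exp (z k))
      (Complex.exp (y k) • (ContinuousLinearMap.proj k : (Fin n → ℂ) →L[ℝ] ℂ)) y := fun y k => by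
    have h1 : HasFDerivAt (fun z : Fin n → ℂ => z k)
        (ContinuousLinearMap.proj k : (Fin n → ℂ) →L[ℝ] ℂ) y :=
      (ContinuousLinearMap.proj k : (Fin n → ℂ) →L[ℝ] ℂ).hasFDerivAt
    exact h1.cexp
  have hE' : ∀ y, HasFDerivAt E (E' y) y := fun y => hasFDerivAt_pi.2 fun k => hcomp y k
  let E'' : (Fin n → ℂ) → (Fin n → ℂ) →L[ℝ] (Fin n → ℂ) := fun v =>
    ContinuousLinearMap.pi fun k => (v k * Complex.exp (z k)) • ContinuousLinearMap.proj k
  have hE'' : ∀ v, HasFDerivAt (fun y => E' y v) (E'' v) z := fun v => by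
    refine hasFDerivAt_pi.2 fun k => ?_
    refine ((hcomp z k).mul_const (v k)).congr_fderiv ?_
    ext w
    simp [mul_assoc]
  have hs : ∀ (k : Fin n) (c : ℂ), E' z (Pi.single k c) = Pi.single k (Complex.exp (z k) * c) := by
    intro k c
    ext l
    by_cases h : l = k
    · subst h; simp [E']
    · simp [E', h]
  -- The contribution of the first derivative of `f`, through the second derivative of `exp`.
  let T : ℂ → ℂ → Fin n → ℂ := fun c d k =>
    Complex.exp (z k) * ((Pi.single i c : Fin n → ℂ) k * (Pi.single j d : Fin n → ℂ) k)
  have h2 : ∀ (c d : ℂ), fderiv ℝ (fderiv ℝ (fun z' => f (E z'))) z (Pi.single i c) (Pi.single j d)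
      = fderiv ℝ (fderiv ℝ f) (E z) (Pi.single i (Complex.exp (z i) * c))
          (Pi.single j (Complex.exp (z j) * d)) +
        fderiv ℝ f (E z) (T c d) := by
    intro c d
    rw [fderiv_fderiv_comp hE hf hE' (hE'' _), hs, hs]
    congr 2
    ext k
    simp only [E'', T, ContinuousLinearMap.coe_pi', _root_.smul_apply,
      ContinuousLinearMap.proj_apply, smul_eq_mul]
    ring
  let S : Fin n → ℂ →ₗ[ℝ] (Fin n → ℂ) := fun k => LinearMap.single ℝ (fun _ : Fin n => ℂ) k
  let M : ℂ →ₗ[ℝ] ℂ →ₗ[ℝ] ℝ := LinearMap.mk₂ ℝ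
    (fun c d => fderiv ℝ (fderiv ℝ f) (E z) (S i c) (S j d))
    (by intros; simp) (by intro a c d; rw [map_smul, map_smul]; rfl) (by intros; simp)
    (by intro a c d; rw [map_smul, map_smul])
  have hM := sesquilinear_part M (Complex.exp (z i)) (Complex.exp (z j))
  simp only [M, S, LinearMap.mk₂_apply, LinearMap.coe_single] at hM
  -- `T` is complex bilinear, as `exp` is holomorphic, so it cancels from the complex Hessian.
  have e1 : T Complex.I Complex.I = -T 1 1 := by
    ext k
    simp only [T, Pi.single_apply, Pi.neg_apply]
    split_ifs <;> simp
  have e2 : T Complex.I 1 = T 1 Complex.I := by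
    ext k
    simp only [T, Pi.single_apply]
    split_ifs <;> simp
  rw [ddbar_apply (f := fun z' => f (E z')) (hf.comp z hE.contDiffAt), ddbar_apply hf,
    h2, h2, h2, h2, e1, e2, map_neg]
  push_cast
  simp only [mul_one]
  linear_combination (1 / 4 : ℂ) * hM

/-- The complex Hessian of a function that factors through a real linear map which kills the
imaginary directions. -/
theorem ddbar_comp_real {V : Type*} [NormedAddCommGroup V] [NormedSpace ℝ V] {G : V → ℝ}
    (hG : ContDiff ℝ 2 G) (L : (Fin n → ℂ) →L[ℝ] V) (hL : ∀ i, L (Pi.single i Complex.I) = 0)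
    (z : Fin n → ℂ) (i j : Fin n) :
    ddbar (fun z' => G (L z')) z i j =
      (1 / 4 : ℂ) * fderiv ℝ (fderiv ℝ G) (L z) (L (Pi.single i 1)) (L (Pi.single j 1)) := by
  have h := fun u v => fderiv_fderiv_comp_affine (f := G) L 0 (z := z) (u := u) (v := v)
    hG.contDiffAt
  simp only [zero_add] at h
  rw [ddbar_apply (f := fun z' => G (L z')) (hG.comp L.contDiff).contDiffAt, h, h, h, h]
  simp [hL]

theorem ddbar_add {f g : (Fin n → ℂ) → ℝ} {y : Fin n → ℂ} (hf : ContDiffAt ℝ 2 f y)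
    (hg : ContDiffAt ℝ 2 g y) : ddbar (fun y => f y + g y) y = ddbar f y + ddbar g y := by
  have h : fderiv ℝ (fderiv ℝ (fun y => f y + g y)) y =
      fderiv ℝ (fderiv ℝ f) y + fderiv ℝ (fderiv ℝ g) y := by
    rw [← (hf.hasFDerivAt_fderiv.add hg.hasFDerivAt_fderiv).fderiv]
    refine Filter.EventuallyEq.fderiv_eq ?_
    filter_upwards [hf.eventually_differentiableAt, hg.eventually_differentiableAt] with y h1 h2
    exact (h1.hasFDerivAt.add h2.hasFDerivAt).fderiv
  ext i j
  rw [Matrix.add_apply, ddbar_apply (hf.add hg), ddbar_apply hf, ddbar_apply hg, h]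
  simp
  ring

theorem ddbar_neg {f : (Fin n → ℂ) → ℝ} {y : Fin n → ℂ} (hf : ContDiffAt ℝ 2 f y) :
    ddbar (fun y => -f y) y = -ddbar f y := by
  have h : fderiv ℝ (fderiv ℝ (fun y => -f y)) y = -fderiv ℝ (fderiv ℝ f) y := by
    have : fderiv ℝ (fun y => -f y) = fun y => -fderiv ℝ f y := by
      ext1 y
      exact fderiv_fun_neg
    rw [this]
    exact fderiv_fun_neg
  ext i j
  rw [Matrix.neg_apply, ddbar_apply hf.neg, ddbar_apply hf, h]
  simp
  ring

theorem ddbar_comp_add {f : (Fin n → ℂ) → ℝ} {y c : Fin n → ℂ} (hf : ContDiffAt ℝ 2 f (c + y)) :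
    ddbar (fun y => f (c + y)) y = ddbar f (c + y) := by
  have h := fun u v => fderiv_fderiv_comp_affine (f := f)
    (ContinuousLinearMap.id ℝ (Fin n → ℂ)) c (z := y) (u := u) (v := v) hf
  simp only [ContinuousLinearMap.id_apply] at h
  ext i j
  rw [ddbar_apply hf, ddbar_apply (f := fun y => f (c + y)) (hf.comp y (by fun_prop))]
  simp only [h]

/-- Liouville's theorem for pluriharmonic functions: bounded ones are constant, being harmonic on
each complex coordinate line. -/
theorem eq_of_ddbar_eq_zero_of_bounded {f : (Fin n → ℂ) → ℝ} (hf : ContDiff ℝ 2 f)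
    (h0 : ∀ z, ddbar f z = 0) {C : ℝ} (hC : ∀ z, |f z| ≤ C) (z w : Fin n → ℂ) : f z = f w := by
  have line : ∀ (z : Fin n → ℂ) (i : Fin n) (t : ℂ), f (z + Pi.single i t) = f z := by
    intro z i t
    let S : ℂ →L[ℝ] (Fin n → ℂ) := ContinuousLinearMap.single ℝ (fun _ : Fin n => ℂ) i
    have hS : ∀ c, S c = Pi.single i c := fun c => rfl
    have hsm : ContDiff ℝ 2 fun t : ℂ => f (z + S t) := hf.comp (by fun_prop)
    have hharm : InnerProductSpace.HarmonicOnNhd (fun t : ℂ => f (z + S t)) univ := by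
      intro t _
      refine ⟨hsm.contDiffAt, Eventually.of_forall fun s => ?_⟩
      rw [InnerProductSpace.laplacian_eq_iteratedFDeriv_complexPlane]
      simp only [iteratedFDeriv_two_apply, Pi.zero_apply]
      have hdd := congrArg (fun A => (A i i).re) (h0 (z + S s))
      simp only [ddbar_apply hf.contDiffAt, Matrix.zero_apply, Complex.zero_re] at hdd
      have h := fun u v => fderiv_fderiv_comp_affine (f := f) S z (z := s) (u := u) (v := v)
        hf.contDiffAt
      refine (congrArg₂ (· + ·) (h 1 1) (h Complex.I Complex.I)).trans ?_
      simpa [hS] using hdd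
    have := InnerProductSpace.bounded_harmonic_on_complex_plane_is_constant _ hharm
      (isBounded_iff_forall_norm_le.2 ⟨C, by rintro _ ⟨t, rfl⟩; exact hC _⟩) t 0
    simpa [hS] using this
  have hsum : ∀ s : Finset (Fin n), f (z + ∑ i ∈ s, Pi.single i ((w - z) i)) = f z := by
    intro s
    induction s using Finset.induction_on with
    | empty => simp
    | insert i s hi ih =>
      rw [Finset.sum_insert hi, add_comm (Pi.single i _), ← add_assoc, line, ih]
  have := hsum Finset.univ
  rw [Finset.univ_sum_single, add_sub_cancel] at this
  exact this.symm

end ComplexHessian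

/-! ### The polytope and its charts -/

namespace FanoPolytope

variable {n : ℕ}

theorem latticePairing_add_smul (a : Fin n → ℤ) (x y : EuclideanSpace ℝ (Fin n)) (s : ℝ) :
    latticePairing a (x + s • y) = latticePairing a x + s * latticePairing a y := by
  simp only [latticePairing, Finset.mul_sum, ← Finset.sum_add_distrib]
  refine Finset.sum_congr rfl fun i _ => ?_
  simp
  ring

theorem latticePairing_zero (a : Fin n → ℤ) :
    latticePairing a (0 : EuclideanSpace ℝ (Fin n)) = 0 := by
  simp [latticePairing]

theorem continuous_latticePairing (a : Fin n → ℤ) :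
    Continuous (latticePairing a : EuclideanSpace ℝ (Fin n) → ℝ) := by
  unfold latticePairing
  fun_prop

variable (P : FanoPolytope n)

theorem isClosed_body : IsClosed P.body := by
  have : P.body = ⋂ a ∈ P.normals, {x | -1 ≤ latticePairing a x} := by
    ext x; simp [body]
  rw [this]
  exact isClosed_biInter fun a _ => isClosed_le continuous_const (continuous_latticePairing a)

theorem isCompact_body : IsCompact P.body :=
  Metric.isCompact_of_isClosed_isBounded P.isClosed_body P.bounded

theorem convex_body : Convex ℝ P.body := by
  intro x hx y hy s t hs ht hst a ha
  have h1 := hx a ha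
  have h2 := hy a ha
  have : latticePairing a (s • x + t • y) = s * latticePairing a x + t * latticePairing a y := by
    have := latticePairing_add_smul a 0 x s
    rw [latticePairing_zero, zero_add, zero_add] at this
    rw [latticePairing_add_smul, this]
  rw [this]
  nlinarith

theorem zero_mem_interior_body : (0 : EuclideanSpace ℝ (Fin n)) ∈ interior P.body := by
  rw [mem_interior_iff_mem_nhds]
  have : ∀ᶠ x in 𝓝 (0 : EuclideanSpace ℝ (Fin n)), ∀ a ∈ P.normals, -1 ≤ latticePairing a x := by
    rw [Filter.eventually_all_finset]
    intro a _
    refine (continuous_latticePairing a).continuousAt.eventually_const_le ?_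
    simp [latticePairing_zero]
  exact this

theorem zero_mem_body : (0 : EuclideanSpace ℝ (Fin n)) ∈ P.body :=
  interior_subset P.zero_mem_interior_body

instance : Nonempty P.body := ⟨⟨0, P.zero_mem_body⟩⟩

theorem exists_closedBall_subset_body : ∃ r > 0, Metric.closedBall 0 r ⊆ P.body :=
  Metric.nhds_basis_closedBall.mem_iff.1 (mem_interior_iff_mem_nhds.1 P.zero_mem_interior_body)

theorem exists_norm_le_body : ∃ R > 0, ∀ x ∈ P.body, ‖x‖ ≤ R :=
  P.bounded.exists_pos_norm_le

variable {P}

namespace Chart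

/-- The integer matrix whose rows are the basis vectors of a chart. -/
def mat (b : P.Chart) : Matrix (Fin n) (Fin n) ℤ := Matrix.of fun i j => b.1 i j

/-- The inverse of `Chart.mat`; its columns form the dual basis. -/
def matInv (b : P.Chart) : Matrix (Fin n) (Fin n) ℤ :=
  Matrix.of fun j i => b.1.repr (Pi.single j 1) i

theorem matInv_mul_mat (b : P.Chart) : b.matInv * b.mat = 1 := by
  ext j k
  have := congrFun (b.1.sum_repr (Pi.single j 1)) k
  simp only [Finset.sum_apply, Pi.smul_apply, smul_eq_mul] at this
  rw [Matrix.mul_apply]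
  simp only [matInv, mat, Matrix.of_apply]
  rw [this, Matrix.one_apply, Pi.single_apply]
  simp only [eq_comm]

theorem mat_mul_matInv (b : P.Chart) : b.mat * b.matInv = 1 :=
  mul_eq_one_comm.1 b.matInv_mul_mat

/-- The logarithmic coordinates `ηᵢ = ∑ⱼ ξⱼ (b*ᵢ)ⱼ = log |yᵢ|²` in the chart `b` of the point of
the torus with `log |w_j|² = ξ_j`. -/
def logCoord (b : P.Chart) (ξ : EuclideanSpace ℝ (Fin n)) (i : Fin n) : ℝ :=
  ∑ j, ξ j * (b.matInv j i : ℝ)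

theorem sum_matInv_mul_mat {R : Type*} [CommRing R] (b : P.Chart) (j k : Fin n) :
    ∑ i, (b.matInv j i : R) * (b.mat i k : R) = if j = k then 1 else 0 := by
  have := congrArg (fun z : ℤ => (z : R)) (congrFun (congrFun b.matInv_mul_mat j) k)
  simp only [Matrix.mul_apply, Matrix.one_apply] at this
  push_cast at this
  exact this

theorem sum_mat_mul_matInv {R : Type*} [CommRing R] (b : P.Chart) (j k : Fin n) :
    ∑ i, (b.mat j i : R) * (b.matInv i k : R) = if j = k then 1 else 0 := by
  have := congrArg (fun z : ℤ => (z : R)) (congrFun (congrFun b.mat_mul_matInv j) k)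
  simp only [Matrix.mul_apply, Matrix.one_apply] at this
  push_cast at this
  exact this

theorem sum_logCoord_mul_mat (b : P.Chart) (ξ : EuclideanSpace ℝ (Fin n)) (k : Fin n) :
    ∑ i, b.logCoord ξ i * (b.mat i k : ℝ) = ξ k := by
  simp only [logCoord, Finset.sum_mul, mul_assoc]
  rw [Finset.sum_comm]
  simp only [← Finset.mul_sum, sum_matInv_mul_mat]
  simp

/-- The point `ξ` with given logarithmic coordinates in the chart `b`. -/
def ofLogCoord (b : P.Chart) : (Fin n → ℝ) →ₗ[ℝ] EuclideanSpace ℝ (Fin n) where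
  toFun η := WithLp.toLp 2 fun k => ∑ i, η i * (b.mat i k : ℝ)
  map_add' η η' := by ext k; simp [add_mul, Finset.sum_add_distrib]
  map_smul' c η := by ext k; simp [Finset.mul_sum, mul_assoc]

theorem ofLogCoord_apply (b : P.Chart) (η : Fin n → ℝ) (k : Fin n) :
    b.ofLogCoord η k = ∑ i, η i * (b.mat i k : ℝ) := rfl

theorem ofLogCoord_logCoord (b : P.Chart) (ξ : EuclideanSpace ℝ (Fin n)) :
    b.ofLogCoord (b.logCoord ξ) = ξ := by
  ext k
  rw [ofLogCoord_apply, sum_logCoord_mul_mat]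

theorem logCoord_ofLogCoord (b : P.Chart) (η : Fin n → ℝ) :
    b.logCoord (b.ofLogCoord η) = η := by
  ext i
  simp only [logCoord, ofLogCoord_apply, Finset.sum_mul, mul_assoc]
  rw [Finset.sum_comm]
  simp only [← Finset.mul_sum, sum_mat_mul_matInv]
  simp

theorem inner_eq_sum_logCoord (b : P.Chart) (x ξ : EuclideanSpace ℝ (Fin n)) :
    ⟪x, ξ⟫ = ∑ i, b.logCoord ξ i * latticePairing (b.1 i) x := by
  have h : ∀ k, ξ k = ∑ i, b.logCoord ξ i * (b.mat i k : ℝ) := fun k =>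
    (b.sum_logCoord_mul_mat ξ k).symm
  simp only [PiLp.inner_apply, RCLike.inner_apply, conj_trivial, latticePairing]
  simp only [Finset.mul_sum]
  rw [Finset.sum_comm]
  refine Finset.sum_congr rfl fun k _ => ?_
  rw [h k, Finset.sum_mul]
  refine Finset.sum_congr rfl fun i _ => ?_
  rw [mul_assoc]
  rfl

theorem mem_normals (b : P.Chart) (i : Fin n) : b.1 i ∈ P.normals := by
  obtain ⟨b, v, hv, hb⟩ := b
  have : b i ∈ Set.range b := ⟨i, rfl⟩
  rw [hb] at this
  exact this.1

instance : Finite P.Chart := by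
  refine Finite.of_injective
    (fun b : P.Chart => fun i => (⟨b.1 i, b.mem_normals i⟩ : P.normals)) ?_
  intro b b' h
  refine Subtype.ext (Module.Basis.eq_of_apply_eq fun i => ?_)
  exact congrArg Subtype.val (congrFun h i)

end Chart

/-- The maximal cones of the normal fan cover the space. A vertex `v` maximizing `⟨·, ξ⟩` has a
chart in which all logarithmic coordinates of `ξ` are nonpositive: if one were positive, moving
from `v` along the corresponding edge of `P` would increase `⟨·, ξ⟩`. -/
theorem exists_chart_logCoord_nonpos (P : FanoPolytope n) (ξ : EuclideanSpace ℝ (Fin n)) :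
    ∃ b : P.Chart, (∀ i, b.logCoord ξ i ≤ 0) ∧ ∃ v ∈ P.body,
      (∀ x ∈ P.body, ⟪x, ξ⟫ ≤ ⟪v, ξ⟫) ∧ ⟪v, ξ⟫ = -∑ i, b.logCoord ξ i := by
  set F : Set (EuclideanSpace ℝ (Fin n)) := {v ∈ P.body | ∀ x ∈ P.body, ⟪x, ξ⟫ ≤ ⟪v, ξ⟫} with hF
  have hexp : IsExposed ℝ P.body F := by
    intro _
    refine ⟨innerSL ℝ ξ, ?_⟩
    ext v
    simp only [hF, innerSL_apply_apply, real_inner_comm]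
  have hne : F.Nonempty := by
    obtain ⟨v, hv, hmax⟩ := P.isCompact_body.exists_isMaxOn ⟨0, P.zero_mem_body⟩
      (f := fun x => ⟪x, ξ⟫) (by fun_prop)
    exact ⟨v, hv, fun x hx => hmax hx⟩
  have hFc : IsCompact F := hexp.isCompact P.isCompact_body
  obtain ⟨v, hv⟩ := hFc.extremePoints_nonempty hne
  have hvP : v ∈ extremePoints ℝ P.body := hexp.isExtreme.extremePoints_subset_extremePoints hv
  obtain ⟨b₀, hb₀⟩ := P.delzant v hvP
  let b : P.Chart := ⟨b₀, v, hvP, hb₀⟩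
  have hact : ∀ i, latticePairing (b.1 i) v = -1 := fun i => by
    have : b₀ i ∈ Set.range b₀ := ⟨i, rfl⟩
    rw [hb₀] at this
    exact this.2
  have hvF : v ∈ F := hv.1
  refine ⟨b, fun i => ?_, v, hvF.1, hvF.2, ?_⟩
  · by_contra! hi
    -- The direction of the edge at `v` along which all active constraints but `bᵢ` stay active.
    let d : EuclideanSpace ℝ (Fin n) := WithLp.toLp 2 fun j => (b.matInv j i : ℝ)
    have hd : ∀ k, latticePairing (b.1 k) d = if k = i then 1 else 0 := fun k =>
      b.sum_mat_mul_matInv k i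
    have hev : ∀ᶠ s in 𝓝[>] (0 : ℝ), ∀ a ∈ P.normals, -1 ≤ latticePairing a (v + s • d) := by
      rw [Filter.eventually_all_finset]
      intro a ha
      by_cases hav : latticePairing a v = -1
      · obtain ⟨k, rfl⟩ : a ∈ Set.range b₀ := hb₀ ▸ ⟨ha, hav⟩
        filter_upwards [self_mem_nhdsWithin] with s hs
        rw [latticePairing_add_smul, hav, hd k]
        split_ifs
        · simpa using le_of_lt hs
        · simp
      · have hlt : -1 < latticePairing a v := lt_of_le_of_ne (hvF.1 a ha) (Ne.symm hav)
        have hc : Continuous fun s : ℝ => latticePairing a (v + s • d) :=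
          (continuous_latticePairing a).comp (by fun_prop)
        have := (hc.tendsto 0).eventually_const_le (u := -1) (by simpa using hlt)
        exact this.filter_mono nhdsWithin_le_nhds
    obtain ⟨s, hs, hs0⟩ := (hev.and self_mem_nhdsWithin).exists
    have h1 := hvF.2 _ hs
    rw [inner_add_left, inner_smul_left] at h1
    have h2 : ⟪d, ξ⟫ = b.logCoord ξ i := by
      rw [b.inner_eq_sum_logCoord]
      simp [hd]
    rw [h2] at h1
    have h3 : 0 < s * b.logCoord ξ i := mul_pos hs0 hi
    simp only [conj_trivial] at h1
    linarith
  · rw [b.inner_eq_sum_logCoord]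
    simp [hact]

namespace Chart

theorem toTorus_exp (b : P.Chart) (ζ : Fin n → ℂ) :
    b.toTorus (fun i => Complex.exp (ζ i)) =
      fun j => Complex.exp (∑ i, ζ i * (b.mat i j : ℂ)) := by
  ext j
  simp only [toTorus, Complex.exp_sum]
  refine Finset.prod_congr rfl fun i _ => ?_
  rw [mul_comm, Complex.exp_int_mul]
  rfl

theorem ofTorus_exp (b : P.Chart) (w : Fin n → ℂ) :
    b.ofTorus (fun i => Complex.exp (w i)) =
      fun i => Complex.exp (∑ j, w j * (b.matInv j i : ℂ)) := by
  ext i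
  simp only [ofTorus, Complex.exp_sum]
  refine Finset.prod_congr rfl fun j _ => ?_
  rw [mul_comm, Complex.exp_int_mul]
  rfl

/-- On the open orbit, the section given by `m` is the character `w^m` up to a factor which does not
depend on `m`. -/
theorem sectionInChart_eq (b : P.Chart) {y : Fin n → ℂ} (hy : ∀ i, y i ≠ 0) {m : Fin n → ℤ}
    (hm : WithLp.toLp 2 (fun k => (m k : ℝ)) ∈ P.body) :
    sectionInChart b y m = (∏ i, y i) * ∏ k, b.toTorus y k ^ m k := by
  have h1 : ∀ i, y i ^ ((∑ k, b.1 i k * m k) + 1).toNat = y i * ∏ k, (y i ^ b.1 i k) ^ m k := by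
    intro i
    have h2 := hm _ (b.mem_normals i)
    have h3 : (0 : ℤ) ≤ (∑ k, b.1 i k * m k) + 1 := by
      have : ((-1 : ℤ) : ℝ) ≤ ((∑ k, b.1 i k * m k : ℤ) : ℝ) := by
        push_cast
        exact h2
      have := Int.cast_le.1 this
      omega
    rw [← zpow_natCast, Int.toNat_of_nonneg h3, zpow_add_one₀ (hy i), mul_comm]
    congr 1
    have : ∀ s : Finset (Fin n),
        y i ^ (∑ k ∈ s, b.1 i k * m k) = ∏ k ∈ s, (y i ^ b.1 i k) ^ m k := by
      intro s
      induction s using Finset.induction_on with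
      | empty => simp
      | insert a s ha ih =>
        rw [Finset.sum_insert ha, Finset.prod_insert ha, zpow_add₀ (hy i), ih, zpow_mul]
    exact this _
  simp only [sectionInChart, h1, Finset.prod_mul_distrib, toTorus]
  rw [Finset.prod_comm]
  simp only [Finset.prod_zpow]

theorem point_eq_point {b b' : P.Chart} {y y' : Fin n → ℂ} (hy : ∀ i, y i ≠ 0)
    (hy' : ∀ i, y' i ≠ 0) (h : b.toTorus y = b'.toTorus y') : b.point y = b'.point y' := by
  refine Quotient.sound ?_
  have hp : ∏ i, y i ≠ 0 := Finset.prod_ne_zero_iff.2 fun i _ => hy i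
  have hp' : ∏ i, y' i ≠ 0 := Finset.prod_ne_zero_iff.2 fun i _ => hy' i
  refine ⟨(∏ i, y i) / ∏ i, y' i, div_ne_zero hp hp', fun m hm => ?_⟩
  rw [b.sectionInChart_eq hy hm, b'.sectionInChart_eq hy' hm, h]
  field_simp

/-- The point of the open orbit with `w = e^{ξ/2}`, seen in an arbitrary chart. -/
theorem torusPoint_eq_point (b : P.Chart) (ξ : EuclideanSpace ℝ (Fin n)) :
    P.torusPoint (fun j => (Real.exp (ξ j / 2) : ℂ)) =
      b.point fun i => Complex.exp ((b.logCoord ξ i / 2 : ℝ) : ℂ) := by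
  have key : ∀ b : P.Chart, b.toTorus (fun i => Complex.exp ((b.logCoord ξ i / 2 : ℝ) : ℂ)) =
      fun j => Complex.exp ((ξ j / 2 : ℝ) : ℂ) := by
    intro b
    rw [toTorus_exp]
    ext j
    congr 1
    rw [← b.sum_logCoord_mul_mat ξ j, Finset.sum_div]
    push_cast
    refine Finset.sum_congr rfl fun i _ => ?_
    ring
  have key' : ∀ b : P.Chart, b.ofTorus (fun j => (Real.exp (ξ j / 2) : ℂ)) =
      fun i => Complex.exp ((b.logCoord ξ i / 2 : ℝ) : ℂ) := by
    intro b
    simp only [Complex.ofReal_exp]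
    rw [ofTorus_exp]
    ext i
    congr 1
    rw [logCoord, Finset.sum_div]
    push_cast
    refine Finset.sum_congr rfl fun i _ => ?_
    ring
  rw [torusPoint, key']
  exact point_eq_point (fun i => Complex.exp_ne_zero _) (fun i => Complex.exp_ne_zero _)
    ((key _).trans (key _).symm)

end Chart

end FanoPolytope

/-! ### Invariant Kähler metrics in logarithmic coordinates -/

/-- The Hessian matrix of a function on Euclidean space. -/
def hessian {n : ℕ} (φ : EuclideanSpace ℝ (Fin n) → ℝ) (ξ : EuclideanSpace ℝ (Fin n)) :
    Matrix (Fin n) (Fin n) ℝ :=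
  Matrix.of fun i j => fderiv ℝ (fderiv ℝ φ) ξ (EuclideanSpace.single i 1)
    (EuclideanSpace.single j 1)

theorem euclidean_eq_sum_single {n : ℕ} (v : EuclideanSpace ℝ (Fin n)) :
    v = ∑ i, v i • EuclideanSpace.single i (1 : ℝ) := by
  ext j
  simp [Finset.sum_apply, Pi.single_apply]

/-- The real linear map `z ↦ (2 Re z_j)_j = (log |e^{z_j}|²)_j`. -/
def twoRe (n : ℕ) : (Fin n → ℂ) →L[ℝ] EuclideanSpace ℝ (Fin n) :=
  LinearMap.toContinuousLinearMap
    { toFun := fun z => WithLp.toLp 2 fun j => 2 * (z j).re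
      map_add' := fun z w => by ext j; simp [mul_add]
      map_smul' := fun c z => by ext j; simp [mul_left_comm] }

theorem twoRe_apply {n : ℕ} (z : Fin n → ℂ) (j : Fin n) : twoRe n z j = 2 * (z j).re := rfl

theorem logAbsSq_exp {n : ℕ} (z : Fin n → ℂ) :
    logAbsSq (fun i => Complex.exp (z i)) = twoRe n z := by
  ext j
  rw [twoRe_apply]
  simp [logAbsSq, Complex.norm_exp]

theorem contDiffAt_logAbsSq {n : ℕ} {w : Fin n → ℂ} (hw : ∀ j, w j ≠ 0) :
    ContDiffAt ℝ 2 (logAbsSq : (Fin n → ℂ) → EuclideanSpace ℝ (Fin n)) w := by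
  refine contDiffAt_euclidean.2 fun j => ?_
  have h1 : ContDiffAt ℝ 2 (fun w : Fin n → ℂ => ‖w j‖ ^ 2) w :=
    ((contDiff_apply ℝ ℂ j).norm_sq ℝ).contDiffAt
  exact h1.log (by simpa using hw j)

namespace FanoPolytope

variable {n : ℕ} {P : FanoPolytope n}

namespace Chart

/-- The real linear map sending `ζ` to `(log |w_j|²)_j` for the point with coordinates `e^{ζᵢ}` in
the chart `b`. -/
def logMap (b : P.Chart) : (Fin n → ℂ) →L[ℝ] EuclideanSpace ℝ (Fin n) :=
  LinearMap.toContinuousLinearMap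
    { toFun := fun ζ => b.ofLogCoord fun i => 2 * (ζ i).re
      map_add' := fun z w => by rw [← map_add]; congr 1; ext j; simp [mul_add]
      map_smul' := fun c z => by
        rw [RingHom.id_apply, ← map_smul]; congr 1; ext j; simp [mul_left_comm] }

theorem logMap_apply (b : P.Chart) (ζ : Fin n → ℂ) :
    b.logMap ζ = b.ofLogCoord fun i => 2 * (ζ i).re := rfl

theorem logCoord_logMap (b : P.Chart) (ζ : Fin n → ℂ) :
    b.logCoord (b.logMap ζ) = fun i => 2 * (ζ i).re :=
  b.logCoord_ofLogCoord _

/-- The real vector `bᵢ`. -/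
def realVec (b : P.Chart) (i : Fin n) : EuclideanSpace ℝ (Fin n) :=
  b.ofLogCoord (Pi.single i 1)

theorem realVec_eq (b : P.Chart) (i : Fin n) :
    b.realVec i = ∑ k, (b.mat i k : ℝ) • EuclideanSpace.single k (1 : ℝ) := by
  rw [euclidean_eq_sum_single (b.realVec i)]
  refine Finset.sum_congr rfl fun k _ => ?_
  congr 1
  rw [realVec, ofLogCoord_apply]
  simp [Pi.single_apply]

theorem eq_sum_logCoord_smul (b : P.Chart) (v : EuclideanSpace ℝ (Fin n)) :
    v = ∑ i, b.logCoord v i • b.realVec i := by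
  conv_lhs => rw [← b.ofLogCoord_logCoord v, ← Finset.univ_sum_single (b.logCoord v), map_sum]
  refine Finset.sum_congr rfl fun i _ => ?_
  rw [realVec, ← map_smul]
  congr 1
  rw [← Pi.single_smul]
  simp

theorem logMap_single_one (b : P.Chart) (i : Fin n) :
    b.logMap (Pi.single i 1) = (2 : ℝ) • b.realVec i := by
  rw [logMap_apply, realVec, ← map_smul]
  congr 1
  ext k
  by_cases h : k = i
  · subst h; simp
  · simp [h]

theorem logMap_single_I (b : P.Chart) (i : Fin n) : b.logMap (Pi.single i Complex.I) = 0 := by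
  rw [logMap_apply, ← map_zero b.ofLogCoord]
  congr 1
  ext k
  by_cases h : k = i
  · subst h; simp
  · simp [h]

theorem logMap_logCoord (b : P.Chart) (ξ : EuclideanSpace ℝ (Fin n)) :
    b.logMap (fun i => ((b.logCoord ξ i / 2 : ℝ) : ℂ)) = ξ := by
  rw [logMap_apply]
  conv_rhs => rw [← b.ofLogCoord_logCoord ξ]
  congr 1
  ext i
  rw [Complex.ofReal_re]
  ring

theorem twoRe_toTorus (b : P.Chart) (ζ : Fin n → ℂ) :
    twoRe n (fun j => ∑ i, ζ i * (b.mat i j : ℂ)) = b.logMap ζ := by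
  ext j
  rw [twoRe_apply, logMap_apply, ofLogCoord_apply, Complex.re_sum, Finset.mul_sum]
  refine Finset.sum_congr rfl fun i _ => ?_
  simp [mul_assoc]

theorem det_mat_sq (b : P.Chart) : b.mat.det * b.mat.det = 1 := by
  have h : IsUnit b.mat.det := by
    refine IsUnit.of_mul_eq_one b.matInv.det ?_
    rw [← Matrix.det_mul, b.mat_mul_matInv, Matrix.det_one]
  rcases Int.isUnit_iff.1 h with h | h <;> rw [h] <;> norm_num

theorem det_hessian_eq (b : P.Chart) (φ : EuclideanSpace ℝ (Fin n) → ℝ)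
    (ξ : EuclideanSpace ℝ (Fin n)) :
    (Matrix.of fun i j => fderiv ℝ (fderiv ℝ φ) ξ (b.realVec i) (b.realVec j)).det =
      (hessian φ ξ).det := by
  have h : (Matrix.of fun i j => fderiv ℝ (fderiv ℝ φ) ξ (b.realVec i) (b.realVec j)) =
      (b.mat.map (Int.cast : ℤ → ℝ)) * hessian φ ξ * (b.mat.map (Int.cast : ℤ → ℝ)).transpose := by
    ext i j
    rw [Matrix.of_apply, b.realVec_eq i, b.realVec_eq j]
    simp only [map_sum, map_smul, _root_.sum_apply, _root_.smul_apply,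
      smul_eq_mul, Matrix.mul_apply, Matrix.transpose_apply, Matrix.map_apply, hessian,
      Matrix.of_apply, Finset.sum_mul, Finset.mul_sum]
    refine Finset.sum_congr rfl fun k _ => Finset.sum_congr rfl fun l _ => ?_
    ring
  have hd : (b.mat.map (Int.cast : ℤ → ℝ)).det = (b.mat.det : ℝ) := by
    have := (Int.castRingHom ℝ).map_det b.mat
    simpa using this.symm
  rw [h, Matrix.det_mul, Matrix.det_mul, Matrix.det_transpose, hd]
  have : (b.mat.det : ℝ) * b.mat.det = 1 := by exact_mod_cast b.det_mat_sq
  linear_combination (hessian φ ξ).det * this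

end Chart

namespace InvariantKahlerMetric

variable {g : P.InvariantKahlerMetric} {φ : EuclideanSpace ℝ (Fin n) → ℝ}

theorem torusCoeff_exp (hφ : g.IsPotential φ) (z : Fin n → ℂ) (k l : Fin n) :
    g.torusCoeff (fun i => Complex.exp (z i)) k l = (hessian φ (twoRe n z) k l : ℂ) := by
  have hne : ∀ j, Complex.exp (z j) ≠ 0 := fun j => Complex.exp_ne_zero _
  have hφ2 : ContDiff ℝ 2 φ := contDiff_infty.1 hφ.1 2
  rw [← hφ.2.1 _ hne, ← ddbar_comp_exp
    (f := fun w => φ (logAbsSq w)) (hφ2.contDiffAt.comp _ (contDiffAt_logAbsSq hne))]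
  simp only [logAbsSq_exp]
  have h1 : ∀ i, twoRe n (Pi.single i 1) = (2 : ℝ) • EuclideanSpace.single i 1 := by
    intro i
    ext k
    rw [twoRe_apply]
    by_cases h : k = i
    · subst h; simp
    · simp [h]
  rw [ddbar_comp_real hφ2, h1, h1]
  · simp only [map_smul, _root_.smul_apply, smul_eq_mul, hessian, Matrix.of_apply]
    push_cast
    ring
  · intro i
    ext k
    rw [twoRe_apply]
    by_cases h : k = i
    · subst h; simp
    · simp [h]

/-- The metric in the logarithmic coordinates of a chart is the Hessian of its potential. -/
theorem coeff_exp (hφ : g.IsPotential φ) (b : P.Chart) (ζ : Fin n → ℂ) (i j : Fin n) :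
    Complex.exp (ζ i) * g.coeff b (fun i => Complex.exp (ζ i)) i j * conj (Complex.exp (ζ j)) =
      (fderiv ℝ (fderiv ℝ φ) (b.logMap ζ) (b.realVec i) (b.realVec j) : ℝ) := by
  rw [g.compatible b (fun i => Complex.exp (ζ i)) (fun i => Complex.exp_ne_zero _) i j,
    b.toTorus_exp]
  simp only [torusCoeff_exp hφ, b.twoRe_toTorus]
  rw [b.realVec_eq i, b.realVec_eq j]
  simp only [map_sum, map_smul, _root_.sum_apply, _root_.smul_apply,
      smul_eq_mul, hessian, Matrix.of_apply, Finset.mul_sum]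
  push_cast
  rw [Finset.sum_comm]
  refine Finset.sum_congr rfl fun k _ => Finset.sum_congr rfl fun l _ => ?_
  simp only [Chart.mat, Matrix.of_apply]
  ring

theorem det_coeff_pos (g : P.InvariantKahlerMetric) (b : P.Chart) (y : Fin n → ℂ) :
    0 < (g.coeff b y).det.re :=
  (Complex.lt_def.1 (g.posDef b y).det_pos).1

theorem hessian_pos (hφ : g.IsPotential φ) (ξ : EuclideanSpace ℝ (Fin n))
    {v : EuclideanSpace ℝ (Fin n)} (hv : v ≠ 0) : 0 < fderiv ℝ (fderiv ℝ φ) ξ v v := by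
  obtain ⟨b⟩ := P.chart_nonempty
  set ζ : Fin n → ℂ := fun i => ((b.logCoord ξ i / 2 : ℝ) : ℂ) with hζ
  have hξ : b.logMap ζ = ξ := b.logMap_logCoord ξ
  set u : Fin n → ℂ := fun i => conj (Complex.exp (ζ i)) * (b.logCoord v i : ℂ) with hu
  have hu0 : u ≠ 0 := by
    intro h
    refine hv ?_
    rw [b.eq_sum_logCoord_smul v]
    refine Finset.sum_eq_zero fun i _ => ?_
    have h1 := congrFun h i
    simp only [hu, Pi.zero_apply, mul_eq_zero, map_eq_zero, Complex.exp_ne_zero, false_or,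
      Complex.ofReal_eq_zero] at h1
    rw [h1, zero_smul]
  have hpos := (g.posDef b fun i => Complex.exp (ζ i)).dotProduct_mulVec_pos hu0
  have heq : star u ⬝ᵥ (g.coeff b fun i => Complex.exp (ζ i)).mulVec u =
      (fderiv ℝ (fderiv ℝ φ) ξ v v : ℝ) := by
    conv_rhs => rw [b.eq_sum_logCoord_smul v]
    simp only [map_sum, map_smul, _root_.sum_apply, _root_.smul_apply,
      smul_eq_mul, dotProduct, Matrix.mulVec, Finset.mul_sum]
    push_cast
    rw [Finset.sum_comm]
    refine Finset.sum_congr rfl fun i _ => Finset.sum_congr rfl fun j _ => ?_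
    rw [← hξ, ← coeff_exp hφ b ζ j i]
    simp only [hu, Pi.star_apply, RCLike.star_def, map_mul, Complex.conj_conj, Complex.conj_ofReal]
    ring
  rw [heq] at hpos
  exact_mod_cast hpos

theorem det_coeff_exp (hφ : g.IsPotential φ) (b : P.Chart) (ζ : Fin n → ℂ) :
    (hessian φ (b.logMap ζ)).det =
      (g.coeff b fun i => Complex.exp (ζ i)).det.re * Real.exp (∑ i, 2 * (ζ i).re) := by
  set M := g.coeff b fun i => Complex.exp (ζ i)
  set D : Matrix (Fin n) (Fin n) ℂ := Matrix.diagonal fun i => Complex.exp (ζ i)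
  have h1 : D * M * D.conjTranspose =
      (Matrix.of fun i j => fderiv ℝ (fderiv ℝ φ) (b.logMap ζ) (b.realVec i) (b.realVec j)).map
        (Complex.ofRealHom) := by
    ext i j
    have := coeff_exp hφ b ζ i j
    simp only [D, Matrix.diagonal_conjTranspose, Matrix.mul_diagonal, Matrix.diagonal_mul,
      Pi.star_apply, RCLike.star_def, Matrix.map_apply, Matrix.of_apply]
    exact this
  have h2 := congrArg Matrix.det h1
  have h3 := Complex.ofRealHom.map_det
    (Matrix.of fun i j => fderiv ℝ (fderiv ℝ φ) (b.logMap ζ) (b.realVec i) (b.realVec j))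
  rw [b.det_hessian_eq] at h3
  rw [RingHom.mapMatrix_apply] at h3
  rw [← h3, Matrix.det_mul, Matrix.det_mul, Matrix.det_conjTranspose, Matrix.det_diagonal] at h2
  have h4 : (∏ i, Complex.exp (ζ i)) * star (∏ i, Complex.exp (ζ i)) =
      (Real.exp (∑ i, 2 * (ζ i).re) : ℂ) := by
    rw [RCLike.star_def, Complex.mul_conj, ← Complex.exp_sum, Complex.normSq_eq_norm_sq,
      Complex.norm_exp, Complex.re_sum, ← Finset.mul_sum, ← Real.exp_nat_mul]
    norm_num
  have h5 : M.det * (Real.exp (∑ i, 2 * (ζ i).re) : ℂ) = ((hessian φ (b.logMap ζ)).det : ℂ) := by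
    rw [← h4]
    calc _ = _ := by ring
      _ = _ := h2
  have h6 := congrArg Complex.re h5
  rw [Complex.ofReal_re, Complex.re_mul_ofReal] at h6
  exact h6.symm

theorem contDiff_det_coeff (g : P.InvariantKahlerMetric) (b : P.Chart) :
    ContDiff ℝ ∞ fun y => (g.coeff b y).det.re := by
  refine Complex.reCLM.contDiff.comp ?_
  simp only [Matrix.det_apply]
  refine ContDiff.sum fun s _ => ?_
  exact (contDiff_prod fun i _ => g.smooth b _ _).const_smul _

theorem contDiff_log_det_coeff (g : P.InvariantKahlerMetric) (b : P.Chart) :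
    ContDiff ℝ ∞ fun y => Real.log (g.coeff b y).det.re :=
  (g.contDiff_det_coeff b).log fun y => (g.det_coeff_pos b y).ne'

theorem det_hessian_pos (hφ : g.IsPotential φ) (ξ : EuclideanSpace ℝ (Fin n)) :
    0 < (hessian φ ξ).det := by
  obtain ⟨b⟩ := P.chart_nonempty
  rw [← b.logMap_logCoord ξ, det_coeff_exp hφ]
  exact mul_pos (g.det_coeff_pos b _) (Real.exp_pos _)

end InvariantKahlerMetric

/-! ### Bounds from the compactness of the toric manifold -/

/-- A family of functions, continuous in the charts, is bounded on the unit polydiscs. -/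
theorem exists_bound_polydisc (F : P.Chart → (Fin n → ℂ) → ℝ) (hF : ∀ b, Continuous (F b)) :
    ∃ C, ∀ (b : P.Chart) (y : Fin n → ℂ), (∀ i, ‖y i‖ ≤ 1) → |F b y| ≤ C := by
  have h : ∀ b, ∃ C, ∀ y : Fin n → ℂ, (∀ i, ‖y i‖ ≤ 1) → |F b y| ≤ C := by
    intro b
    obtain ⟨C, hC⟩ := (isCompact_closedBall (0 : Fin n → ℂ) 1).exists_bound_of_continuousOn
      (hF b).continuousOn
    refine ⟨C, fun y hy => hC y ?_⟩
    rw [mem_closedBall_zero_iff]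
    exact (pi_norm_le_iff_of_nonneg zero_le_one).2 hy
  choose C hC using h
  obtain ⟨M, hM⟩ := (Set.finite_range C).bddAbove
  exact ⟨M, fun b y hy => (hC b y hy).trans (hM ⟨b, rfl⟩)⟩

/-- Every point of the open orbit lies in the unit polydisc of some chart. -/
theorem exists_bound_exp {ρ : P.X → ℝ} (hρ : P.SmoothFunction ρ) :
    ∃ C, ∀ (b : P.Chart) (ζ : Fin n → ℂ), |ρ (b.point fun i => Complex.exp (ζ i))| ≤ C := by
  obtain ⟨C, hC⟩ := exists_bound_polydisc (fun b y => ρ (b.point y)) fun b => (hρ b).continuous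
  refine ⟨C, fun b ζ => ?_⟩
  obtain ⟨b', hb', -⟩ := P.exists_chart_logCoord_nonpos (b.logMap ζ)
  set w : Fin n → ℂ := fun j => ∑ i, ζ i * (b.mat i j : ℂ) with hw
  set ζ' : Fin n → ℂ := fun i => ∑ j, w j * (b'.matInv j i : ℂ) with hζ'
  have h1 : (fun j => ∑ i, ζ' i * (b'.mat i j : ℂ)) = w := by
    ext j
    simp only [hζ', Finset.sum_mul, mul_assoc]
    rw [Finset.sum_comm]
    simp only [← Finset.mul_sum, Chart.sum_matInv_mul_mat]
    simp
  have h2 : b'.logMap ζ' = b.logMap ζ := by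
    rw [← b.twoRe_toTorus, ← b'.twoRe_toTorus, h1]
  have h3 : ∀ i, (ζ' i).re ≤ 0 := fun i => by
    have := hb' i
    rw [← h2, b'.logCoord_logMap] at this
    linarith
  have h4 : b.point (fun i => Complex.exp (ζ i)) = b'.point fun i => Complex.exp (ζ' i) := by
    refine Chart.point_eq_point (fun i => Complex.exp_ne_zero _) (fun i => Complex.exp_ne_zero _) ?_
    rw [b.toTorus_exp, b'.toTorus_exp]
    ext j
    exact congrArg Complex.exp (congrFun h1 j).symm
  rw [h4]
  refine hC b' _ fun i => ?_
  rw [Complex.norm_exp]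
  exact Real.exp_le_one_iff.2 (h3 i)

/-- The determinant of the Hessian of the potential decays like `e^{-h_P}`, with `h_P` the support
function of `P`, since the metric is smooth and positive up to the boundary divisor. -/
theorem InvariantKahlerMetric.exists_bound_log_det_hessian {g : P.InvariantKahlerMetric}
    {φ : EuclideanSpace ℝ (Fin n) → ℝ} (hφ : g.IsPotential φ) :
    ∃ C, ∀ ξ, ∃ v ∈ P.body, (∀ x ∈ P.body, ⟪x, ξ⟫ ≤ ⟪v, ξ⟫) ∧
      |Real.log (hessian φ ξ).det + ⟪v, ξ⟫| ≤ C := by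
  obtain ⟨C, hC⟩ := exists_bound_polydisc (fun b y => Real.log (g.coeff b y).det.re)
    fun b => (g.contDiff_log_det_coeff b).continuous
  refine ⟨C, fun ξ => ?_⟩
  obtain ⟨b, hb, v, hv, hmax, hvξ⟩ := P.exists_chart_logCoord_nonpos ξ
  refine ⟨v, hv, hmax, ?_⟩
  set ζ : Fin n → ℂ := fun i => ((b.logCoord ξ i / 2 : ℝ) : ℂ) with hζ
  have hdet := det_coeff_exp hφ b ζ
  rw [b.logMap_logCoord] at hdet
  have hsum : ∑ i, 2 * (ζ i).re = ∑ i, b.logCoord ξ i := by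
    refine Finset.sum_congr rfl fun i _ => ?_
    rw [hζ, Complex.ofReal_re]
    ring
  rw [hdet, Real.log_mul (g.det_coeff_pos b _).ne' (Real.exp_ne_zero _), Real.log_exp, hsum, hvξ,
    add_assoc, add_neg_cancel, add_zero]
  refine hC b _ fun i => ?_
  rw [Complex.norm_exp, hζ, Complex.ofReal_re]
  exact Real.exp_le_one_iff.2 (by have := hb i; linarith)

end FanoPolytope

/-! ### The Monge–Ampère equation of the potential -/

namespace FanoPolytope

variable {n : ℕ} {P : FanoPolytope n}

/-- The restriction of a function on `X` to the positive real points `w = e^{ξ/2}` of the open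
orbit. -/
def orbitFun (ρ : P.X → ℝ) (ξ : EuclideanSpace ℝ (Fin n)) : ℝ :=
  ρ (P.torusPoint fun j => (Real.exp (ξ j / 2) : ℂ))

theorem orbitFun_eq (ρ : P.X → ℝ) (b : P.Chart) (ξ : EuclideanSpace ℝ (Fin n)) :
    orbitFun ρ ξ = ρ (b.point fun i => Complex.exp ((b.logCoord ξ i / 2 : ℝ) : ℂ)) := by
  rw [orbitFun, b.torusPoint_eq_point]

theorem contDiff_exp_pi : ContDiff ℝ ∞ fun (ζ : Fin n → ℂ) (i : Fin n) => Complex.exp (ζ i) :=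
  contDiff_pi.2 fun i => (Complex.contDiff_exp (𝕜 := ℝ)).comp (contDiff_apply ℝ ℂ i)

theorem contDiff_logCoord (b : P.Chart) :
    ContDiff ℝ ∞ fun (ξ : EuclideanSpace ℝ (Fin n)) (i : Fin n) =>
      ((b.logCoord ξ i / 2 : ℝ) : ℂ) := by
  refine contDiff_pi.2 fun i => Complex.ofRealCLM.contDiff.comp (ContDiff.div_const ?_ 2)
  unfold Chart.logCoord
  fun_prop

theorem contDiff_orbitFun {ρ : P.X → ℝ} (hρ : P.SmoothFunction ρ) :
    ContDiff ℝ ∞ (orbitFun ρ) := by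
  obtain ⟨b⟩ := P.chart_nonempty
  have h : orbitFun ρ = fun ξ => ρ (b.point fun i => Complex.exp ((b.logCoord ξ i / 2 : ℝ) : ℂ)) :=
    funext fun ξ => orbitFun_eq ρ b ξ
  rw [h]
  exact (hρ b).comp (contDiff_exp_pi.comp (contDiff_logCoord b))

theorem exists_bound_orbitFun {ρ : P.X → ℝ} (hρ : P.SmoothFunction ρ) :
    ∃ C, ∀ ξ, |orbitFun ρ ξ| ≤ C := by
  obtain ⟨b⟩ := P.chart_nonempty
  obtain ⟨C, hC⟩ := exists_bound_exp hρ
  exact ⟨C, fun ξ => by rw [orbitFun_eq ρ b]; exact hC b _⟩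

namespace InvariantKahlerMetric

variable {g : P.InvariantKahlerMetric} {φ : EuclideanSpace ℝ (Fin n) → ℝ} {ρ : P.X → ℝ}

/-- The Ricci potential equation in logarithmic coordinates: `log det + φ + ρ` is pluriharmonic. -/
theorem ddbar_ricci_eq_zero (hρ : g.IsNormalizedRicciPotential ρ) (hφ : g.IsPotential φ)
    (b : P.Chart) (ζ : Fin n → ℂ) :
    ddbar (fun ζ => Real.log (g.coeff b fun i => Complex.exp (ζ i)).det.re + φ (b.logMap ζ)
      + ρ (b.point fun i => Complex.exp (ζ i))) ζ = 0 := by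
  have hφ2 : ContDiff ℝ 2 φ := contDiff_infty.1 hφ.1 2
  have hE : ContDiff ℝ 2 fun (ζ : Fin n → ℂ) (i : Fin n) => Complex.exp (ζ i) :=
    contDiff_infty.1 contDiff_exp_pi 2
  have h1 : ContDiff ℝ 2 fun y => Real.log (g.coeff b y).det.re :=
    contDiff_infty.1 (g.contDiff_log_det_coeff b) 2
  have h3 : ContDiff ℝ 2 fun y => ρ (b.point y) := contDiff_infty.1 (hρ.1 b) 2
  have h1' : ContDiff ℝ 2 fun ζ : Fin n → ℂ =>
      Real.log (g.coeff b fun i => Complex.exp (ζ i)).det.re := h1.comp hE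
  have h2' : ContDiff ℝ 2 fun ζ : Fin n → ℂ => φ (b.logMap ζ) := hφ2.comp b.logMap.contDiff
  have h3' : ContDiff ℝ 2 fun ζ : Fin n → ℂ => ρ (b.point fun i => Complex.exp (ζ i)) :=
    h3.comp hE
  ext i j
  rw [ddbar_add (h1'.add h2').contDiffAt h3'.contDiffAt,
    ddbar_add h1'.contDiffAt h2'.contDiffAt, Matrix.add_apply, Matrix.add_apply, Matrix.zero_apply,
    ddbar_comp_exp (f := fun y => Real.log (g.coeff b y).det.re) h1.contDiffAt,
    ddbar_comp_exp (f := fun y => ρ (b.point y)) h3.contDiffAt,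
    ddbar_comp_real hφ2 b.logMap b.logMap_single_I, b.logMap_single_one, b.logMap_single_one]
  have hR := congrFun (congrFun (hρ.2.1 b fun i => Complex.exp (ζ i)) i) j
  rw [Matrix.sub_apply, Matrix.neg_apply] at hR
  have hc := coeff_exp hφ b ζ i j
  simp only [map_smul, _root_.smul_apply, smul_eq_mul]
  push_cast
  linear_combination (-Complex.exp (ζ i) * conj (Complex.exp (ζ j))) * hR - hc

theorem log_det_coeff_exp (hφ : g.IsPotential φ) (b : P.Chart) (ζ : Fin n → ℂ) :
    Real.log (g.coeff b fun i => Complex.exp (ζ i)).det.re =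
      Real.log (hessian φ (b.logMap ζ)).det - ∑ i, 2 * (ζ i).re := by
  rw [det_coeff_exp hφ, Real.log_mul (g.det_coeff_pos b _).ne' (Real.exp_ne_zero _), Real.log_exp]
  ring

/-- The Ricci potential is invariant under the compact torus. Its increment under a rotation is
bounded and pluriharmonic, hence constant, and the constant vanishes because iterating the
rotation keeps `ρ` bounded. -/
theorem ricciPotential_rotate (hρ : g.IsNormalizedRicciPotential ρ) (hφ : g.IsPotential φ)
    (b : P.Chart) {c : Fin n → ℂ} (hc : ∀ i, (c i).re = 0) (ζ : Fin n → ℂ) :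
    ρ (b.point fun i => Complex.exp ((c + ζ) i)) = ρ (b.point fun i => Complex.exp (ζ i)) := by
  set r : (Fin n → ℂ) → ℝ := fun ζ => ρ (b.point fun i => Complex.exp (ζ i)) with hr
  set q : (Fin n → ℂ) → ℝ := fun ζ =>
    Real.log (g.coeff b fun i => Complex.exp (ζ i)).det.re + φ (b.logMap ζ) + r ζ with hq
  have hE : ContDiff ℝ 2 fun (ζ : Fin n → ℂ) (i : Fin n) => Complex.exp (ζ i) :=
    contDiff_infty.1 contDiff_exp_pi 2
  have hr2 : ContDiff ℝ 2 r := (contDiff_infty.1 (hρ.1 b) 2).comp hE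
  have hq2 : ContDiff ℝ 2 q :=
    (((contDiff_infty.1 (g.contDiff_log_det_coeff b) 2).comp hE).add
      ((contDiff_infty.1 hφ.1 2).comp b.logMap.contDiff)).add hr2
  have hL : b.logMap c = 0 := by
    rw [Chart.logMap_apply, ← map_zero b.ofLogCoord]
    congr 1
    ext i
    simp [hc]
  have hdiff : ∀ ζ, r (c + ζ) + -r ζ = q (c + ζ) + -q ζ := by
    intro ζ
    simp only [hq, log_det_coeff_exp hφ, map_add, hL, zero_add, Pi.add_apply, Complex.add_re, hc]
    ring
  obtain ⟨C, hC⟩ := exists_bound_exp hρ.1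
  have hconst : ∀ ζ, r (c + ζ) + -r ζ = r (c + 0) + -r 0 := by
    intro ζ
    refine eq_of_ddbar_eq_zero_of_bounded (f := fun ζ => r (c + ζ) + -r ζ) (C := C + C)
      ((hr2.comp (by fun_prop)).add hr2.neg) (fun ζ => ?_) (fun ζ => ?_) ζ 0
    · simp only [hdiff]
      rw [ddbar_add (f := fun ζ => q (c + ζ)) (hq2.comp (by fun_prop)).contDiffAt
        hq2.neg.contDiffAt,
        ddbar_neg hq2.contDiffAt, ddbar_comp_add hq2.contDiffAt, ddbar_ricci_eq_zero hρ hφ,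
        ddbar_ricci_eq_zero hρ hφ, neg_zero, add_zero]
    · refine (abs_add_le _ _).trans (add_le_add (hC b _) ?_)
      rw [abs_neg]
      exact hC b _
  set κ := r (c + 0) + -r 0
  have hiter : ∀ k : ℕ, r ((k : ℂ) • c) = r 0 + k * κ := by
    intro k
    induction k with
    | zero => simp
    | succ k ih =>
      have := hconst ((k : ℂ) • c)
      push_cast
      rw [add_smul, one_smul, add_comm _ c]
      linarith
  have hκ : κ = 0 := by
    by_contra hne
    obtain ⟨k, hk⟩ := exists_nat_gt ((C + C) / |κ|)
    rw [div_lt_iff₀ (abs_pos.2 hne)] at hk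
    have h1 : (k : ℝ) * κ = r ((k : ℂ) • c) - r 0 := by rw [hiter]; ring
    have h2 : |(k : ℝ) * κ| ≤ C + C := by
      rw [h1]
      exact (abs_sub _ _).trans (add_le_add (hC b _) (hC b _))
    rw [abs_mul, Nat.abs_cast] at h2
    linarith
  have := hconst ζ
  rw [hκ] at this
  linarith

theorem ricciPotential_exp (hρ : g.IsNormalizedRicciPotential ρ) (hφ : g.IsPotential φ)
    (b : P.Chart) (ζ : Fin n → ℂ) :
    ρ (b.point fun i => Complex.exp (ζ i)) = orbitFun ρ (b.logMap ζ) := by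
  rw [orbitFun_eq ρ b, b.logCoord_logMap]
  rw [← ricciPotential_rotate hρ hφ b (c := fun i => (-(ζ i).im : ℝ) * Complex.I) (by simp) ζ]
  congr 2
  ext i
  congr 1
  apply Complex.ext <;> simp

/-- As `∇φ ∈ P`, the potential grows at most like the support function of `P`, which is at
most `⟪v, ξ⟫` at `ξ`. -/
theorem potential_le (hφ : g.IsPotential φ) {ξ v : EuclideanSpace ℝ (Fin n)}
    (hv : ∀ x ∈ P.body, ⟪x, ξ⟫ ≤ ⟪v, ξ⟫) : φ ξ ≤ φ 0 + ⟪v, ξ⟫ := by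
  have hd : Differentiable ℝ φ := hφ.1.differentiable (by simp)
  have hline : ∀ t : ℝ, HasDerivAt (fun t : ℝ => φ (t • ξ)) ⟪∇ φ (t • ξ), ξ⟫ t := by
    intro t
    have h1 : HasDerivAt (fun t : ℝ => t • ξ) ξ t := by
      simpa using (hasDerivAt_id t).smul_const ξ
    have h2 := (hd (t • ξ)).hasGradientAt.hasFDerivAt.comp_hasDerivAt t h1
    exact h2.congr_deriv (by simp)
  have h3 := image_sub_le_mul_sub_of_deriv_le (f := fun t : ℝ => φ (t • ξ)) (C := ⟪v, ξ⟫)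
    (fun t => (hline t).differentiableAt)
    (fun t => by rw [(hline t).deriv]; exact hv _ (hφ.2.2 _)) (zero_le_one (α := ℝ))
  simp at h3
  linarith

/-- A smooth function of `ξ` whose pull-back to a chart is pluriharmonic is affine. -/
theorem _root_.FanoPolytope.Chart.affine_of_ddbar_eq_zero (b : P.Chart)
    {G : EuclideanSpace ℝ (Fin n) → ℝ} (hG : ContDiff ℝ 2 G)
    (h0 : ∀ ζ, ddbar (fun ζ => G (b.logMap ζ)) ζ = 0) :
    ∃ ℓ : EuclideanSpace ℝ (Fin n) →L[ℝ] ℝ, ∀ ξ, G ξ = G 0 + ℓ ξ := by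
  have h2 : ∀ ξ, fderiv ℝ (fderiv ℝ G) ξ = 0 := by
    intro ξ
    have hb : ∀ i j, fderiv ℝ (fderiv ℝ G) ξ (b.realVec i) (b.realVec j) = 0 := by
      intro i j
      have := congrFun (congrFun (h0 fun i => ((b.logCoord ξ i / 2 : ℝ) : ℂ)) i) j
      rw [ddbar_comp_real hG b.logMap b.logMap_single_I, b.logMap_single_one,
        b.logMap_single_one, b.logMap_logCoord] at this
      simp only [map_smul, _root_.smul_apply, smul_eq_mul, Matrix.zero_apply] at this
      simpa using this
    ext u v
    rw [b.eq_sum_logCoord_smul u, b.eq_sum_logCoord_smul v]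
    simp [_root_.sum_apply, hb]
  have h1 : ∀ ξ, fderiv ℝ G ξ = fderiv ℝ G 0 := fun ξ =>
    is_const_of_fderiv_eq_zero (𝕜 := ℝ)
      ((hG.fderiv_right (m := 1) (by norm_num)).differentiable (by norm_num)) h2 ξ 0
  refine ⟨fderiv ℝ G 0, fun ξ => ?_⟩
  have hd : Differentiable ℝ G := hG.differentiable (by norm_num)
  have := is_const_of_fderiv_eq_zero (𝕜 := ℝ) (f := fun ξ => G ξ - fderiv ℝ G 0 ξ)
    (hd.sub (fderiv ℝ G 0).differentiable) (fun ξ => by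
      rw [fderiv_fun_sub (hd ξ) (fderiv ℝ G 0).differentiableAt, h1, ContinuousLinearMap.fderiv,
        sub_self]) ξ 0
  simp at this
  linarith

/-- The real Monge–Ampère equation `det D²φ = e^{d - φ - ρ}`. Torus invariance and pluriharmonicity
give it up to a linear term in the exponent; that term is bounded above by the asymptotics of
`det D²φ` and by `∇φ ∈ P`, so it vanishes. -/
theorem exists_monge_ampere (hρ : g.IsNormalizedRicciPotential ρ) (hφ : g.IsPotential φ) :
    ∃ d, ∀ ξ, Real.log (hessian φ ξ).det + φ ξ + orbitFun ρ ξ = d := by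
  obtain ⟨b⟩ := P.chart_nonempty
  set G : EuclideanSpace ℝ (Fin n) → ℝ := fun ξ =>
    Real.log (g.coeff b fun i => Complex.exp ((b.logCoord ξ i / 2 : ℝ) : ℂ)).det.re + φ ξ
      + orbitFun ρ ξ with hG
  have hG2 : ContDiff ℝ 2 G := contDiff_infty.1
    ((((g.contDiff_log_det_coeff b).comp (contDiff_exp_pi.comp (contDiff_logCoord b))).add
      hφ.1).add (contDiff_orbitFun hρ.1)) 2
  have hlog : ∀ ξ, Real.log (g.coeff b fun i => Complex.exp ((b.logCoord ξ i / 2 : ℝ) : ℂ)).det.re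
      = Real.log (hessian φ ξ).det - ∑ i, b.logCoord ξ i := by
    intro ξ
    rw [log_det_coeff_exp hφ, b.logMap_logCoord]
    congr 1
    refine Finset.sum_congr rfl fun i _ => ?_
    rw [Complex.ofReal_re]
    ring
  obtain ⟨ℓ, hℓ⟩ := b.affine_of_ddbar_eq_zero hG2 fun ζ => by
    have : (fun ζ => G (b.logMap ζ)) = fun ζ =>
        Real.log (g.coeff b fun i => Complex.exp (ζ i)).det.re + φ (b.logMap ζ)
          + ρ (b.point fun i => Complex.exp (ζ i)) := by
      ext ζ
      simp only [hG]
      rw [hlog, log_det_coeff_exp hφ, b.logCoord_logMap, ricciPotential_exp hρ hφ]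
    rw [this]
    exact ddbar_ricci_eq_zero hρ hφ b ζ
  obtain ⟨C₁, hC₁⟩ := exists_bound_log_det_hessian hφ
  obtain ⟨C₂, hC₂⟩ := exists_bound_orbitFun hρ.1
  let S : EuclideanSpace ℝ (Fin n) →ₗ[ℝ] ℝ :=
    { toFun := fun ξ => ∑ i, b.logCoord ξ i
      map_add' := fun x y => by
        simp [Chart.logCoord, add_mul, Finset.sum_add_distrib]
      map_smul' := fun c x => by
        simp [Chart.logCoord, Finset.mul_sum, mul_assoc] }
  let ℓ' : EuclideanSpace ℝ (Fin n) →ₗ[ℝ] ℝ := ℓ.toLinearMap + S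
  have heq : ∀ ξ, Real.log (hessian φ ξ).det + φ ξ + orbitFun ρ ξ = G 0 + ℓ' ξ := by
    intro ξ
    have h1 := hℓ ξ
    have h2 : G ξ = Real.log (hessian φ ξ).det - S ξ + φ ξ + orbitFun ρ ξ := by
      simp only [hG, hlog]
      rfl
    have h3 : ℓ' ξ = ℓ ξ + S ξ := rfl
    linarith
  -- With `v` maximizing `⟪·, ξ⟫`, the support function cancels between `log det D²φ` and `φ`.
  have hbd : ∀ ξ, ℓ' ξ ≤ C₁ + φ 0 + C₂ - G 0 := by
    intro ξ
    obtain ⟨v, hv, hmax, hlogdet⟩ := hC₁ ξ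
    have h1 := potential_le hφ hmax
    have h2 := (abs_le.1 hlogdet).2
    have h3 := (abs_le.1 (hC₂ ξ)).2
    have h4 := heq ξ
    linarith
  have hzero : ∀ ξ, ℓ' ξ ≤ 0 := by
    intro ξ
    by_contra! h
    obtain ⟨k, hk⟩ := exists_nat_gt ((C₁ + φ 0 + C₂ - G 0) / ℓ' ξ)
    rw [div_lt_iff₀ h] at hk
    have := hbd ((k : ℝ) • ξ)
    rw [map_smul, smul_eq_mul] at this
    linarith
  refine ⟨G 0, fun ξ => ?_⟩
  have h1 := hzero ξ
  have h2 := hzero (-ξ)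
  rw [map_neg] at h2
  rw [heq]
  linarith

/-- The potential grows at least like the support function of `P`. -/
theorem exists_inner_sub_potential_le (hρ : g.IsNormalizedRicciPotential ρ)
    (hφ : g.IsPotential φ) : ∃ C, ∀ ξ, ∀ x ∈ P.body, ⟪x, ξ⟫ - φ ξ ≤ C := by
  obtain ⟨d, hd⟩ := exists_monge_ampere hρ hφ
  obtain ⟨C₁, hC₁⟩ := exists_bound_log_det_hessian hφ
  obtain ⟨C₂, hC₂⟩ := exists_bound_orbitFun hρ.1
  refine ⟨C₁ + C₂ - d, fun ξ x hx => ?_⟩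
  obtain ⟨v, hv, hmax, hlogdet⟩ := hC₁ ξ
  have h1 := hmax x hx
  have h2 := (abs_le.1 hlogdet).2
  have h3 := (abs_le.1 (hC₂ ξ)).2
  have h4 := hd ξ
  linarith

end InvariantKahlerMetric

end FanoPolytope

/-! ### The gradient map and the symplectic potential -/

namespace FanoPolytope

variable {n : ℕ}

/-- Smooth functions with positive definite Hessian whose gradient map takes values in `P` and
which grow at least like the support function of `P`. -/
structure IsConvexPotential (P : FanoPolytope n) (φ : EuclideanSpace ℝ (Fin n) → ℝ) : Prop where
  smooth : ContDiff ℝ ∞ φ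
  hessian_pos : ∀ ξ v, v ≠ 0 → 0 < fderiv ℝ (fderiv ℝ φ) ξ v v
  gradient_mem : ∀ ξ, ∇ φ ξ ∈ P.body
  growth : ∃ C, ∀ ξ, ∀ x ∈ P.body, ⟪x, ξ⟫ - φ ξ ≤ C

namespace IsConvexPotential

variable {P : FanoPolytope n} {φ : EuclideanSpace ℝ (Fin n) → ℝ}

theorem hasFDerivAt (h : P.IsConvexPotential φ) (ξ : EuclideanSpace ℝ (Fin n)) :
    HasFDerivAt φ (fderiv ℝ φ ξ) ξ :=
  ((h.smooth.differentiable (by simp)) ξ).hasFDerivAt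

theorem _root_.inner_gradient_eq_fderiv (φ : EuclideanSpace ℝ (Fin n) → ℝ)
    (ξ v : EuclideanSpace ℝ (Fin n)) :
    ⟪∇ φ ξ, v⟫ = fderiv ℝ φ ξ v := by
  rw [gradient, InnerProductSpace.toDual_symm_apply]

theorem lt_of_ne (h : P.IsConvexPotential φ) {ξ η : EuclideanSpace ℝ (Fin n)} (hne : ξ ≠ η) :
    φ ξ + ⟪∇ φ ξ, η - ξ⟫ < φ η := by
  set v := η - ξ with hv
  have hv0 : v ≠ 0 := sub_ne_zero.2 hne.symm
  have hline : ∀ t : ℝ, HasDerivAt (fun t : ℝ => ξ + t • v) v t := fun t => by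
    simpa using ((hasDerivAt_id t).smul_const v).const_add ξ
  have h1 : ∀ t : ℝ, HasDerivAt (fun t : ℝ => φ (ξ + t • v)) (fderiv ℝ φ (ξ + t • v) v) t :=
    fun t => (h.hasFDerivAt _).comp_hasDerivAt t (hline t)
  have h2 : ∀ t : ℝ, HasDerivAt (fun t : ℝ => fderiv ℝ φ (ξ + t • v) v)
      (fderiv ℝ (fderiv ℝ φ) (ξ + t • v) v v) t := fun t => by
    have h3 : HasFDerivAt (fderiv ℝ φ) (fderiv ℝ (fderiv ℝ φ) (ξ + t • v)) (ξ + t • v) :=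
      (contDiff_infty.1 h.smooth 2).contDiffAt.hasFDerivAt_fderiv
    exact ((ContinuousLinearMap.apply ℝ ℝ v).hasFDerivAt.comp _ h3).comp_hasDerivAt t (hline t)
  have hmono : StrictMono fun t : ℝ => fderiv ℝ φ (ξ + t • v) v :=
    strictMono_of_deriv_pos fun t => by rw [(h2 t).deriv]; exact h.hessian_pos _ _ hv0
  obtain ⟨c, hc, hcs⟩ := exists_hasDerivAt_eq_slope (fun t : ℝ => φ (ξ + t • v))
    (fun t : ℝ => fderiv ℝ φ (ξ + t • v) v) zero_lt_one
    (fun t _ => (h1 t).continuousAt.continuousWithinAt) (fun t _ => h1 t)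
  have := hmono hc.1
  simp only [zero_smul, add_zero, one_smul, sub_zero, div_one] at this hcs
  rw [inner_gradient_eq_fderiv]
  have hη : ξ + v = η := by rw [hv]; abel
  rw [hη] at hcs
  linarith

theorem le_apply (h : P.IsConvexPotential φ) (ξ η : EuclideanSpace ℝ (Fin n)) :
    φ ξ + ⟪∇ φ ξ, η - ξ⟫ ≤ φ η := by
  rcases eq_or_ne ξ η with rfl | hne
  · simp
  · exact (h.lt_of_ne hne).le

theorem injective_gradient (h : P.IsConvexPotential φ) : Function.Injective (∇ φ) := by
  intro ξ η hξη
  by_contra hne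
  have h1 := h.lt_of_ne hne
  have h2 := h.lt_of_ne (Ne.symm hne)
  rw [← hξη, ← neg_sub η ξ, inner_neg_right] at h2
  linarith

/-- The inverse of the Riesz isomorphism, as a real linear map. -/
def rieszInv (n : ℕ) :
    StrongDual ℝ (EuclideanSpace ℝ (Fin n)) →L[ℝ] EuclideanSpace ℝ (Fin n) where
  toFun := (InnerProductSpace.toDual ℝ (EuclideanSpace ℝ (Fin n))).symm
  map_add' := map_add _
  map_smul' c f := by simp
  cont := (InnerProductSpace.toDual ℝ (EuclideanSpace ℝ (Fin n))).symm.continuous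

/-- The derivative of the gradient map. -/
def gradientDeriv (φ : EuclideanSpace ℝ (Fin n) → ℝ) (ξ : EuclideanSpace ℝ (Fin n)) :
    EuclideanSpace ℝ (Fin n) →L[ℝ] EuclideanSpace ℝ (Fin n) :=
  (rieszInv n).comp (fderiv ℝ (fderiv ℝ φ) ξ)

theorem inner_gradientDeriv (ξ u v : EuclideanSpace ℝ (Fin n)) :
    ⟪gradientDeriv φ ξ u, v⟫ = fderiv ℝ (fderiv ℝ φ) ξ u v :=
  InnerProductSpace.toDual_symm_apply (𝕜 := ℝ)

theorem det_gradientDeriv (ξ : EuclideanSpace ℝ (Fin n)) :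
    (gradientDeriv φ ξ).det = (hessian φ ξ).det := by
  rw [ContinuousLinearMap.det, ← LinearMap.det_toMatrix
    (EuclideanSpace.basisFun (Fin n) ℝ).toBasis, ← Matrix.det_transpose]
  congr 1
  ext i j
  rw [Matrix.transpose_apply, LinearMap.toMatrix_apply, hessian, Matrix.of_apply,
    ← inner_gradientDeriv]
  simp [EuclideanSpace.inner_single_right]

theorem contDiff_gradient (h : P.IsConvexPotential φ) : ContDiff ℝ 1 (∇ φ) := by
  have h1 : ContDiff ℝ 1 (fderiv ℝ φ) := (contDiff_infty.1 h.smooth 2).fderiv_right (by norm_num)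
  exact (rieszInv n).contDiff.comp h1

theorem hasStrictFDerivAt_gradient (h : P.IsConvexPotential φ) (ξ : EuclideanSpace ℝ (Fin n)) :
    HasStrictFDerivAt (∇ φ) (gradientDeriv φ ξ) ξ := by
  refine h.contDiff_gradient.contDiffAt.hasStrictFDerivAt' ?_ (by norm_num)
  have h3 : HasFDerivAt (fderiv ℝ φ) (fderiv ℝ (fderiv ℝ φ) ξ) ξ :=
    (contDiff_infty.1 h.smooth 2).contDiffAt.hasFDerivAt_fderiv
  exact (rieszInv n).hasFDerivAt.comp ξ h3

theorem exists_equiv_gradientDeriv (h : P.IsConvexPotential φ) (ξ : EuclideanSpace ℝ (Fin n)) :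
    ∃ A : EuclideanSpace ℝ (Fin n) ≃L[ℝ] EuclideanSpace ℝ (Fin n),
      (A : EuclideanSpace ℝ (Fin n) →L[ℝ] EuclideanSpace ℝ (Fin n)) = gradientDeriv φ ξ := by
  have hinj : Function.Injective (gradientDeriv φ ξ).toLinearMap := by
    rw [← LinearMap.ker_eq_bot, LinearMap.ker_eq_bot']
    intro v hv
    by_contra hne
    have := h.hessian_pos ξ v hne
    rw [← inner_gradientDeriv] at this
    erw [hv] at this
    simp at this
  refine ⟨(LinearEquiv.ofInjectiveEndo _ hinj).toContinuousLinearEquiv, ?_⟩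
  ext1 v
  rfl

theorem isOpenMap_gradient (h : P.IsConvexPotential φ) : IsOpenMap (∇ φ) := by
  choose A hA using h.exists_equiv_gradientDeriv
  exact isOpenMap_of_hasStrictFDerivAt_equiv (f' := A) fun ξ => by
    rw [hA]; exact h.hasStrictFDerivAt_gradient ξ

/-- The gradient map is onto the interior of `P`: for `x` in the interior, `φ - ⟨x, ·⟩` is proper
and attains its minimum. -/
theorem range_gradient (h : P.IsConvexPotential φ) : range (∇ φ) = interior P.body := by
  refine Subset.antisymm (interior_maximal ?_ h.isOpenMap_gradient.isOpen_range) ?_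
  · rintro _ ⟨ξ, rfl⟩
    exact h.gradient_mem ξ
  · intro x hx
    obtain ⟨r, hr, hball⟩ := Metric.nhds_basis_closedBall.mem_iff.1
      (mem_interior_iff_mem_nhds.1 hx)
    obtain ⟨C, hC⟩ := h.growth
    have hlow : ∀ ξ, r * ‖ξ‖ - C ≤ φ ξ - ⟪x, ξ⟫ := by
      intro ξ
      have hmem : x + (r / ‖ξ‖) • ξ ∈ P.body := hball (by
        rw [mem_closedBall_iff_norm, add_sub_cancel_left, norm_smul, norm_div, norm_norm,
          Real.norm_of_nonneg hr.le]
        rcases eq_or_ne ‖ξ‖ 0 with h0 | h0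
        · simp [h0, hr.le]
        · rw [div_mul_cancel₀ _ h0])
      have h1 := hC ξ _ hmem
      rw [inner_add_left, inner_smul_left, real_inner_self_eq_norm_sq, conj_trivial] at h1
      have h2 : r / ‖ξ‖ * ‖ξ‖ ^ 2 = r * ‖ξ‖ := by
        rcases eq_or_ne ‖ξ‖ 0 with h0 | h0
        · simp [h0]
        · field_simp
      linarith
    have hcont : Continuous fun ξ => φ ξ - ⟪x, ξ⟫ :=
      h.smooth.continuous.sub (by fun_prop)
    obtain ⟨ξ, hξ⟩ := hcont.exists_forall_le (tendsto_atTop_mono hlow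
      (tendsto_atTop_add_const_right _ (-C)
        ((tendsto_norm_cocompact_atTop (E := EuclideanSpace ℝ (Fin n))).const_mul_atTop hr)))
    refine ⟨ξ, ?_⟩
    have hmin : IsLocalMin (fun ξ => φ ξ - ⟪x, ξ⟫) ξ := Eventually.of_forall hξ
    have h3 := hmin.hasFDerivAt_eq_zero ((h.hasFDerivAt ξ).sub (innerSL ℝ x).hasFDerivAt)
    refine ext_inner_right ℝ fun v => ?_
    have h4 := congrArg (fun A => A v) h3
    simp only [_root_.sub_apply, innerSL_apply_apply, _root_.zero_apply] at h4
    rw [inner_gradient_eq_fderiv]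
    linarith

theorem bddAbove_symplectic (h : P.IsConvexPotential φ) {x : EuclideanSpace ℝ (Fin n)}
    (hx : x ∈ P.body) : BddAbove (range fun ξ => ⟪x, ξ⟫ - φ ξ) := by
  obtain ⟨C, hC⟩ := h.growth
  exact ⟨C, by rintro _ ⟨ξ, rfl⟩; exact hC ξ x hx⟩

theorem le_symplecticPotential (h : P.IsConvexPotential φ) {x : EuclideanSpace ℝ (Fin n)}
    (hx : x ∈ P.body) (ξ : EuclideanSpace ℝ (Fin n)) :
    ⟪x, ξ⟫ - φ ξ ≤ symplecticPotential φ x :=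
  le_ciSup (h.bddAbove_symplectic hx) ξ

theorem symplecticPotential_gradient (h : P.IsConvexPotential φ)
    (ξ : EuclideanSpace ℝ (Fin n)) :
    symplecticPotential φ (∇ φ ξ) = ⟪∇ φ ξ, ξ⟫ - φ ξ := by
  refine le_antisymm (ciSup_le fun η => ?_) (h.le_symplecticPotential (h.gradient_mem ξ) ξ)
  have := h.le_apply ξ η
  rw [inner_sub_right] at this
  linarith

/-- The gradient of the symplectic potential inverts the gradient map. With `ξ'` the preimage of a
nearby point, the remainder of the first-order expansion is at most `⟨∇φ(ξ') - ∇φ(ξ), ξ' - ξ⟩`. -/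
theorem gradient_symplecticPotential (h : P.IsConvexPotential φ)
    (ξ : EuclideanSpace ℝ (Fin n)) : ∇ (symplecticPotential φ) (∇ φ ξ) = ξ := by
  refine HasGradientAt.gradient ?_
  obtain ⟨A, hA⟩ := h.exists_equiv_gradientDeriv ξ
  have hstrict := h.hasStrictFDerivAt_gradient ξ
  rw [← hA] at hstrict
  have hmap := hstrict.map_nhds_eq_of_equiv
  rw [hasGradientAt_iff_isLittleO, ← hmap, Asymptotics.isLittleO_map]
  rw [Asymptotics.isLittleO_iff]
  intro c hc
  filter_upwards [Metric.ball_mem_nhds ξ hc] with ξ' hξ'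
  have h1 := h.le_symplecticPotential (h.gradient_mem ξ') ξ
  have h2 := h.le_symplecticPotential (h.gradient_mem ξ) ξ'
  have h3 := h.symplecticPotential_gradient ξ
  have h4 := h.symplecticPotential_gradient ξ'
  simp only [Function.comp_apply]
  have h5 : ⟪ξ, ∇ φ ξ' - ∇ φ ξ⟫ = ⟪∇ φ ξ', ξ⟫ - ⟪∇ φ ξ, ξ⟫ := by
    rw [real_inner_comm, inner_sub_left]
  have h6 : ⟪∇ φ ξ' - ∇ φ ξ, ξ' - ξ⟫ = ⟪∇ φ ξ', ξ'⟫ - ⟪∇ φ ξ', ξ⟫ - (⟪∇ φ ξ, ξ'⟫ - ⟪∇ φ ξ, ξ⟫) := by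
    rw [inner_sub_left, inner_sub_right, inner_sub_right]
  have h7 := real_inner_le_norm (∇ φ ξ' - ∇ φ ξ) (ξ' - ξ)
  have h8 : ‖ξ' - ξ‖ ≤ c := (mem_ball_iff_norm.1 hξ').le
  have h9 : ‖∇ φ ξ' - ∇ φ ξ‖ * ‖ξ' - ξ‖ ≤ c * ‖∇ φ ξ' - ∇ φ ξ‖ := by
    rw [mul_comm]
    exact mul_le_mul_of_nonneg_right h8 (norm_nonneg _)
  rw [Real.norm_eq_abs, abs_le]
  constructor
  · have : 0 ≤ c * ‖∇ φ ξ' - ∇ φ ξ‖ := by positivity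
    linarith
  · linarith

end IsConvexPotential

/-! ### Convex functions on the polytope -/

/-- Near a point `x₀` of the polytope, the polytope is a cone with apex `x₀`. -/
theorem exists_conical (P : FanoPolytope n) {x₀ : EuclideanSpace ℝ (Fin n)} (hx₀ : x₀ ∈ P.body) :
    ∃ δ > 0, ∀ x ∈ P.body, ∀ s, 0 < s → ‖x - x₀‖ ≤ δ * s → x₀ + s⁻¹ • (x - x₀) ∈ P.body := by
  have hev : ∀ᶠ δ in 𝓝[>] (0 : ℝ), ∀ a ∈ P.normals, ∀ x ∈ P.body, ∀ s, 0 < s →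
      ‖x - x₀‖ ≤ δ * s → -1 ≤ latticePairing a (x₀ + s⁻¹ • (x - x₀)) := by
    rw [Filter.eventually_all_finset]
    intro a ha
    have hsub : ∀ x, latticePairing a (x - x₀) = latticePairing a x - latticePairing a x₀ := by
      intro x
      have := latticePairing_add_smul a x x₀ (-1)
      rw [neg_one_smul, ← sub_eq_add_neg] at this
      rw [this]
      ring
    rcases eq_or_lt_of_le (hx₀ a ha) with hact | hlt
    · refine Eventually.of_forall fun δ x hx s hs _ => ?_
      rw [latticePairing_add_smul, ← hact, hsub, ← hact]
      have h1 := hx a ha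
      have : 0 ≤ s⁻¹ * (latticePairing a x - -1) :=
        mul_nonneg (inv_nonneg.2 hs.le) (by linarith)
      linarith
    · set a' : EuclideanSpace ℝ (Fin n) := WithLp.toLp 2 fun k => (a k : ℝ) with ha'
      have hin : ∀ z, latticePairing a z = ⟪z, a'⟫ := fun z => by
        simp [latticePairing, PiLp.inner_apply, ha']
      have h2 : ∀ᶠ δ in 𝓝 (0 : ℝ), δ * ‖a'‖ < latticePairing a x₀ + 1 :=
        ((continuous_id.mul continuous_const).tendsto' 0 0 (by simp)).eventually_lt_const
          (by linarith)
      filter_upwards [h2.filter_mono nhdsWithin_le_nhds] with δ hδ x hx s hs hxs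
      rw [latticePairing_add_smul, hin (x - x₀)]
      have h3 : |⟪x - x₀, a'⟫| ≤ δ * s * ‖a'‖ :=
        (abs_real_inner_le_norm _ _).trans (mul_le_mul_of_nonneg_right hxs (norm_nonneg _))
      have h4 := (abs_le.1 h3).1
      have h5 : -(δ * ‖a'‖) ≤ s⁻¹ * ⟪x - x₀, a'⟫ := by
        rw [inv_mul_eq_div, le_div_iff₀ hs]
        linarith
      linarith
  obtain ⟨δ, hδ, hδ0⟩ := (hev.and self_mem_nhdsWithin).exists
  exact ⟨δ, hδ0, fun x hx s hs hxs a ha => hδ a ha x hx s hs hxs⟩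

/-- A bounded convex function on a polytope is upper semicontinuous. -/
theorem eventually_lt_of_convexOn (P : FanoPolytope n) {u : EuclideanSpace ℝ (Fin n) → ℝ}
    (hu : ConvexOn ℝ P.body u) {M : ℝ} (hM : ∀ x ∈ P.body, |u x| ≤ M)
    {x₀ : EuclideanSpace ℝ (Fin n)} (hx₀ : x₀ ∈ P.body) {a : ℝ} (ha : u x₀ < a) :
    ∀ᶠ x in 𝓝[P.body] x₀, u x < a := by
  obtain ⟨δ, hδ, hcone⟩ := P.exists_conical hx₀
  obtain ⟨s, hs, hs0⟩ : ∃ s : ℝ, (s < 1 ∧ s * (2 * M) < a - u x₀) ∧ 0 < s := by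
    have h1 : ∀ᶠ s in 𝓝 (0 : ℝ), s < 1 ∧ s * (2 * M) < a - u x₀ :=
      (eventually_lt_nhds zero_lt_one).and
        (((continuous_id.mul continuous_const).tendsto' 0 0 (by simp)).eventually_lt_const
          (by linarith))
    exact ((h1.filter_mono nhdsWithin_le_nhds).and
      (self_mem_nhdsWithin (s := Ioi (0 : ℝ)))).exists
  have hball : Metric.closedBall x₀ (δ * s) ∈ 𝓝[P.body] x₀ :=
    nhdsWithin_le_nhds (Metric.closedBall_mem_nhds _ (by positivity))
  filter_upwards [hball, self_mem_nhdsWithin] with x hx hxP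
  have hz := hcone x hxP s hs0 (mem_closedBall_iff_norm.1 hx)
  set z := x₀ + s⁻¹ • (x - x₀)
  have hxz : (1 - s) • x₀ + s • z = x := by
    simp only [z, smul_add, smul_smul, mul_inv_cancel₀ hs0.ne', one_smul, sub_smul]
    abel
  have h1 := hu.2 hx₀ hz (by linarith [hs.1] : 0 ≤ 1 - s) hs0.le (by ring)
  rw [hxz, smul_eq_mul, smul_eq_mul] at h1
  have h2 := abs_le.1 (hM _ hx₀)
  have h3 := abs_le.1 (hM _ hz)
  have h4 : s * (u z - u x₀) ≤ s * (2 * M) := mul_le_mul_of_nonneg_left (by linarith) hs0.le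
  linarith [hs.2]

/-- The symplectic potential is convex and continuous up to the boundary of `P`. -/
theorem IsConvexPotential.symplecticPotential_mem_convZero {P : FanoPolytope n}
    {φ : EuclideanSpace ℝ (Fin n) → ℝ} (h : P.IsConvexPotential φ) :
    symplecticPotential φ ∈ P.convZero := by
  obtain ⟨C, hC⟩ := h.growth
  have hconv : ConvexOn ℝ P.body (symplecticPotential φ) := by
    refine ⟨P.convex_body, fun x hx y hy s t hs ht hst => ciSup_le fun ξ => ?_⟩
    have h1 := mul_le_mul_of_nonneg_left (h.le_symplecticPotential hx ξ) hs
    have h2 := mul_le_mul_of_nonneg_left (h.le_symplecticPotential hy ξ) ht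
    rw [inner_add_left, inner_smul_left, inner_smul_left]
    simp only [conj_trivial, smul_eq_mul]
    have h3 : φ ξ = s * φ ξ + t * φ ξ := by rw [← add_mul, hst, one_mul]
    linarith
  have hbd : ∀ x ∈ P.body, |symplecticPotential φ x| ≤ max C (φ 0) := by
    intro x hx
    have h1 := h.le_symplecticPotential hx 0
    rw [inner_zero_right] at h1
    have h2 : symplecticPotential φ x ≤ C := ciSup_le fun ξ => hC ξ x hx
    rw [abs_le]
    constructor
    · linarith [le_max_right C (φ 0)]
    · linarith [le_max_left C (φ 0)]
  refine ⟨fun x₀ hx₀ => ?_, hconv⟩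
  refine tendsto_order.2 ⟨fun a ha => ?_, fun a ha => P.eventually_lt_of_convexOn hconv hbd hx₀ ha⟩
  obtain ⟨ξ, hξ⟩ := exists_lt_of_lt_ciSup ha
  have hc : Continuous fun x : EuclideanSpace ℝ (Fin n) => ⟪x, ξ⟫ - φ ξ := by fun_prop
  filter_upwards [(hc.continuousAt.eventually_const_lt hξ).filter_mono nhdsWithin_le_nhds,
    self_mem_nhdsWithin] with x hx hxP
  exact hx.trans_le (h.le_symplecticPotential hxP ξ)

end FanoPolytope

/-! ### The Legendre transform and the Ding functional -/

theorem integrable_exp_neg_mul_norm {n : ℕ} {r : ℝ} (hr : 0 < r) :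
    Integrable fun x : EuclideanSpace ℝ (Fin n) => Real.exp (-(r * ‖x‖)) := by
  have h1 : Integrable fun x : EuclideanSpace ℝ (Fin n) =>
      (1 + ‖x‖) ^ (-((n + 1 : ℕ) : ℝ)) := by
    apply integrable_one_add_norm
    rw [finrank_euclideanSpace_fin]
    exact_mod_cast Nat.lt_succ_self n
  -- The constant comes from `(r (1 + ‖x‖))^k / k! ≤ e^{r (1 + ‖x‖)}` with `k = n + 1`.
  refine (h1.const_mul (Real.exp r * (n + 1).factorial / r ^ (n + 1))).mono'
    (by fun_prop) (Eventually.of_forall fun x => ?_)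
  have hx : 0 < 1 + ‖x‖ := by positivity
  have h2 := Real.pow_div_factorial_le_exp (r * (1 + ‖x‖)) (by positivity) (n + 1)
  rw [Real.norm_of_nonneg (Real.exp_pos _).le, Real.rpow_neg hx.le, Real.rpow_natCast]
  have h3 : Real.exp (r * (1 + ‖x‖)) * Real.exp (-(r * ‖x‖)) = Real.exp r := by
    rw [← Real.exp_add]
    ring_nf
  rw [← h3]
  have hk : (0 : ℝ) < (n + 1).factorial := by positivity
  rw [div_le_iff₀ hk, mul_pow] at h2
  have h4 : Real.exp (-(r * ‖x‖)) * (r ^ (n + 1) * (1 + ‖x‖) ^ (n + 1)) ≤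
      Real.exp (-(r * ‖x‖)) * (Real.exp (r * (1 + ‖x‖)) * (n + 1).factorial) :=
    mul_le_mul_of_nonneg_left h2 (Real.exp_pos _).le
  rw [← div_eq_mul_inv, div_div, le_div_iff₀ (by positivity)]
  linarith

/-- The Prékopa–Leindler inequality for log-densities. -/
theorem integral_exp_neg_rpow_mul_le {n : ℕ} {t : ℝ} (ht0 : 0 < t) (ht1 : t < 1)
    {ψ₀ ψ₁ ψ : EuclideanSpace ℝ (Fin n) → ℝ} (h₀ : Continuous ψ₀) (h₁ : Continuous ψ₁)
    (h : Continuous ψ) (i₀ : Integrable fun x => Real.exp (-ψ₀ x))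
    (i₁ : Integrable fun x => Real.exp (-ψ₁ x)) (i : Integrable fun x => Real.exp (-ψ x))
    (hle : ∀ x y, ψ ((1 - t) • x + t • y) ≤ (1 - t) * ψ₀ x + t * ψ₁ y) :
    (∫ x, Real.exp (-ψ₀ x)) ^ (1 - t) * (∫ x, Real.exp (-ψ₁ x)) ^ t ≤ ∫ x, Real.exp (-ψ x) := by
  have hs : 0 < 1 - t := by linarith
  have hm : ∀ {k : EuclideanSpace ℝ (Fin n) → ℝ}, Continuous k →
      Measurable fun x => ENNReal.ofReal (Real.exp (-k x)) := fun hk => by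
    have : Continuous fun x => Real.exp (-_) := Real.continuous_exp.comp hk.neg
    exact this.measurable.ennreal_ofReal
  have key := prekopa_leindler ht0 ht1 (hm h₀) (hm h₁) (hm h) fun x y => by
    rw [ENNReal.ofReal_rpow_of_pos (Real.exp_pos _), ENNReal.ofReal_rpow_of_pos (Real.exp_pos _),
      ← ENNReal.ofReal_mul (by positivity), ← Real.exp_mul, ← Real.exp_mul, ← Real.exp_add]
    refine ENNReal.ofReal_le_ofReal (Real.exp_le_exp.2 ?_)
    linarith [hle x y]
  have hnn : ∀ k : EuclideanSpace ℝ (Fin n) → ℝ, 0 ≤ ∫ x, Real.exp (-k x) := fun k =>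
    integral_nonneg fun x => (Real.exp_pos _).le
  have hl : ∀ {k : EuclideanSpace ℝ (Fin n) → ℝ}, (Integrable fun x => Real.exp (-k x)) →
      ∫⁻ x, ENNReal.ofReal (Real.exp (-k x)) = ENNReal.ofReal (∫ x, Real.exp (-k x)) := fun hk =>
    (ofReal_integral_eq_lintegral_ofReal hk (ae_of_all _ fun x => (Real.exp_pos _).le)).symm
  rw [hl i₀, hl i₁, hl i, ENNReal.ofReal_rpow_of_nonneg (hnn _) hs.le,
    ENNReal.ofReal_rpow_of_nonneg (hnn _) ht0.le,
    ← ENNReal.ofReal_mul (Real.rpow_nonneg (hnn _) _)] at key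
  exact (ENNReal.ofReal_le_ofReal_iff (hnn _)).1 key

namespace FanoPolytope

variable {n : ℕ} {P : FanoPolytope n} {u : EuclideanSpace ℝ (Fin n) → ℝ}

theorem exists_bound_of_mem_convZero (hu : u ∈ P.convZero) : ∃ M, ∀ x ∈ P.body, |u x| ≤ M :=
  P.isCompact_body.exists_bound_of_continuousOn hu.1

theorem le_legendre (hu : u ∈ P.convZero) (ξ : EuclideanSpace ℝ (Fin n))
    {x : EuclideanSpace ℝ (Fin n)} (hx : x ∈ P.body) : ⟪x, ξ⟫ - u x ≤ P.legendre u ξ := by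
  obtain ⟨M, hM⟩ := exists_bound_of_mem_convZero hu
  obtain ⟨R, -, hR⟩ := P.exists_norm_le_body
  refine le_ciSup (f := fun x : P.body => ⟪(x : EuclideanSpace ℝ (Fin n)), ξ⟫ - u x)
    ⟨R * ‖ξ‖ + M, ?_⟩ ⟨x, hx⟩
  rintro _ ⟨y, rfl⟩
  have h1 := real_inner_le_norm (y : EuclideanSpace ℝ (Fin n)) ξ
  have h2 := mul_le_mul_of_nonneg_right (hR y y.2) (norm_nonneg ξ)
  have h3 := (abs_le.1 (hM y y.2)).1
  simp only
  linarith

theorem legendre_le {ξ : EuclideanSpace ℝ (Fin n)} {c : ℝ}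
    (h : ∀ x ∈ P.body, ⟪x, ξ⟫ - u x ≤ c) : P.legendre u ξ ≤ c :=
  ciSup_le fun x : P.body => h x x.2

theorem continuous_legendre (hu : u ∈ P.convZero) : Continuous (P.legendre u) := by
  obtain ⟨R, hR0, hR⟩ := P.exists_norm_le_body
  refine (LipschitzWith.of_le_add_mul ⟨R, hR0.le⟩ fun ξ η => legendre_le fun x hx => ?_).continuous
  have h1 := le_legendre hu η hx
  have h2 := real_inner_le_norm x (ξ - η)
  have h3 := mul_le_mul_of_nonneg_right (hR x hx) (norm_nonneg (ξ - η))
  rw [inner_sub_right] at h2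
  rw [dist_eq_norm]
  change _ ≤ _ + R * _
  linarith

/-- The Legendre transform of a function on `P` grows at least linearly, as `0` is an interior
point of `P`. -/
theorem exists_le_legendre (hu : u ∈ P.convZero) :
    ∃ r > 0, ∃ M, ∀ ξ, r * ‖ξ‖ - M ≤ P.legendre u ξ := by
  obtain ⟨M, hM⟩ := exists_bound_of_mem_convZero hu
  obtain ⟨r, hr, hball⟩ := P.exists_closedBall_subset_body
  refine ⟨r, hr, M, fun ξ => ?_⟩
  have hmem : (r / ‖ξ‖) • ξ ∈ P.body := hball (by
    rw [mem_closedBall_zero_iff, norm_smul, norm_div, norm_norm, Real.norm_of_nonneg hr.le]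
    rcases eq_or_ne ‖ξ‖ 0 with h0 | h0
    · simp [h0, hr.le]
    · rw [div_mul_cancel₀ _ h0])
  have h1 := le_legendre hu ξ hmem
  rw [inner_smul_left, real_inner_self_eq_norm_sq, conj_trivial] at h1
  have h2 : r / ‖ξ‖ * ‖ξ‖ ^ 2 = r * ‖ξ‖ := by
    rcases eq_or_ne ‖ξ‖ 0 with h0 | h0
    · simp [h0]
    · field_simp
  have h3 := (abs_le.1 (hM _ hmem)).2
  linarith

theorem integrable_exp_neg_legendre (hu : u ∈ P.convZero) :
    Integrable fun ξ => Real.exp (-P.legendre u ξ) := by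
  obtain ⟨r, hr, M, hM⟩ := exists_le_legendre hu
  refine ((integrable_exp_neg_mul_norm hr).const_mul (Real.exp M)).mono'
    (Real.continuous_exp.comp (continuous_legendre hu).neg).aestronglyMeasurable
    (Eventually.of_forall fun ξ => ?_)
  rw [Real.norm_of_nonneg (Real.exp_pos _).le, ← Real.exp_add]
  exact Real.exp_le_exp.2 (by linarith [hM ξ])

theorem integral_exp_neg_legendre_pos (hu : u ∈ P.convZero) :
    0 < ∫ ξ, Real.exp (-P.legendre u ξ) :=
  integral_exp_pos (integrable_exp_neg_legendre hu)

/-- A continuous convex function on `P` has a subgradient at the origin, by separating `(0, u(0))`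
from the strict epigraph over the interior of `P`. -/
theorem exists_subgradient_zero (hu : u ∈ P.convZero) :
    ∃ η : EuclideanSpace ℝ (Fin n), ∀ x ∈ P.body, u 0 + ⟪x, η⟫ ≤ u x := by
  set S : Set (EuclideanSpace ℝ (Fin n) × ℝ) := {p | p.1 ∈ interior P.body ∧ u p.1 < p.2}
  have hconvI : ConvexOn ℝ (interior P.body) u :=
    hu.2.subset interior_subset P.convex_body.interior
  have hopen : IsOpen S := by
    have h1 : ContinuousOn (fun p : EuclideanSpace ℝ (Fin n) × ℝ => p.2 - u p.1)
        (interior P.body ×ˢ univ) :=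
      continuousOn_snd.sub ((hu.1.mono interior_subset).comp continuousOn_fst fun p hp => hp.1)
    have h2 := h1.isOpen_inter_preimage (isOpen_interior.prod isOpen_univ) (isOpen_Ioi (a := 0))
    convert h2 using 1
    ext p
    simp [S]
  obtain ⟨f, hf⟩ := geometric_hahn_banach_open_point hconvI.convex_strict_epigraph hopen
    (x := ((0 : EuclideanSpace ℝ (Fin n)), u 0)) fun h => lt_irrefl _ h.2
  set c := f (0, 1) with hc
  have hsplit : ∀ x t, f (x, t) = f (x, 0) + t * c := by
    intro x t
    have : ((x, t) : EuclideanSpace ℝ (Fin n) × ℝ) = (x, 0) + t • (0, 1) := by simp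
    rw [this, map_add, map_smul, smul_eq_mul]
  have hc0 : c < 0 := by
    have := hf (0, u 0 + 1) ⟨P.zero_mem_interior_body, by simp⟩
    rw [hsplit 0 (u 0 + 1), hsplit 0 (u 0)] at this
    linarith
  set η : EuclideanSpace ℝ (Fin n) := (-c⁻¹) • (InnerProductSpace.toDual ℝ _).symm
    (f.comp (ContinuousLinearMap.inl ℝ _ ℝ)) with hη
  have hinner : ∀ x, ⟪x, η⟫ = -c⁻¹ * f (x, 0) := by
    intro x
    rw [hη, inner_smul_right, real_inner_comm, InnerProductSpace.toDual_symm_apply]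
    rfl
  have hint : ∀ x ∈ interior P.body, u 0 + ⟪x, η⟫ ≤ u x := by
    intro x hx
    refine le_of_forall_pos_le_add fun ε hε => ?_
    have h1 := hf (x, u x + ε) ⟨hx, by simpa using hε⟩
    rw [hsplit x, hsplit 0, show f (0, 0) = 0 from map_zero f] at h1
    have h2 : -c⁻¹ * (f (x, 0) + (u x + ε) * c) < -c⁻¹ * (0 + u 0 * c) :=
      mul_lt_mul_of_pos_left h1 (by simpa using inv_lt_zero.2 hc0)
    have h3 : ∀ s : ℝ, -c⁻¹ * (s * c) = -s := fun s => by
      field_simp [hc0.ne]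
    rw [mul_add, h3, zero_add, h3] at h2
    rw [hinner]
    linarith
  refine ⟨η, fun x hx => ?_⟩
  have hhalf : (1 / 2 : ℝ) • x ∈ interior P.body := by
    have := P.convex_body.combo_interior_self_mem_interior P.zero_mem_interior_body hx
      (a := 1 / 2) (b := 1 / 2) (by norm_num) (by norm_num) (by norm_num)
    simpa using this
  have h1 := hint _ hhalf
  have h2 := hu.2.2 P.zero_mem_body hx (by norm_num : (0 : ℝ) ≤ 1 / 2)
    (by norm_num : (0 : ℝ) ≤ 1 / 2) (by norm_num)
  rw [inner_smul_left, conj_trivial] at h1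
  simp only [smul_zero, zero_add, smul_eq_mul] at h2
  linarith

theorem iInf_legendre (hu : u ∈ P.convZero) : ⨅ η, P.legendre u η = -u 0 := by
  have hlow : ∀ η, -u 0 ≤ P.legendre u η := fun η => by
    have := le_legendre hu η P.zero_mem_body
    rw [inner_zero_left] at this
    linarith
  refine le_antisymm ?_ (le_ciInf hlow)
  obtain ⟨η, hη⟩ := exists_subgradient_zero hu
  refine (ciInf_le ⟨-u 0, by rintro _ ⟨η, rfl⟩; exact hlow η⟩ η).trans (legendre_le fun x hx => ?_)
  linarith [hη x hx]

theorem dingDensity_eq (hu : u ∈ P.convZero) (ξ : EuclideanSpace ℝ (Fin n)) :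
    P.dingDensity u ξ = Real.exp (-u 0) * Real.exp (-P.legendre u ξ) := by
  rw [dingDensity, iInf_legendre hu, ← Real.exp_add]
  congr 1
  ring

theorem integrable_dingDensity (hu : u ∈ P.convZero) : Integrable (P.dingDensity u) := by
  rw [funext (dingDensity_eq hu)]
  exact (integrable_exp_neg_legendre hu).const_mul _

/-- The normalization by `inf φ` cancels the term `-u(0)` of the functional. -/
theorem ding_eq (hu : u ∈ P.convZero) (σ : EuclideanSpace ℝ (Fin n) → ℝ) :
    P.ding σ u = -Real.log (∫ ξ, Real.exp (-P.legendre u ξ))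
      + (1 / P.vol) * ∫ x in P.body, u x * σ x := by
  rw [ding, dingNA, funext (dingDensity_eq hu), integral_const_mul,
    Real.log_mul (Real.exp_ne_zero _) (integral_exp_neg_legendre_pos hu).ne', Real.log_exp]
  ring

theorem add_smul_mem_convZero {u₀ u : EuclideanSpace ℝ (Fin n) → ℝ} (hu₀ : u₀ ∈ P.convZero)
    (hu : u ∈ P.convZero) {t : ℝ} (ht0 : 0 ≤ t) (ht1 : t ≤ 1) :
    (fun x => (1 - t) * u₀ x + t * u x) ∈ P.convZero :=
  ⟨(hu₀.1.const_mul _).add (hu.1.const_mul _),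
    (hu₀.2.smul (sub_nonneg.2 ht1)).add (hu.2.smul ht0)⟩

theorem IsConvexPotential.legendre_symplecticPotential {φ : EuclideanSpace ℝ (Fin n) → ℝ}
    (h : P.IsConvexPotential φ) : P.legendre (symplecticPotential φ) = φ := by
  ext ξ
  refine le_antisymm (legendre_le fun x hx => ?_) ?_
  · linarith [h.le_symplecticPotential hx ξ]
  · have := le_legendre h.symplecticPotential_mem_convZero ξ (h.gradient_mem ξ)
    rw [h.symplecticPotential_gradient] at this
    linarith

/-- The variational inequality for `log ∫ e^{-φ}`. By Prékopa–Leindler it is concave along segments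
of symplectic potentials, and its derivative at the symplectic potential of `φ` in the direction
of `u` is at most the average of `u - u₀` with respect to the image of `e^{-φ}` under `∇φ`. -/
theorem IsConvexPotential.log_integral_le {φ : EuclideanSpace ℝ (Fin n) → ℝ}
    (h : P.IsConvexPotential φ) (hu : u ∈ P.convZero) :
    Real.log (∫ ξ, Real.exp (-P.legendre u ξ)) - Real.log (∫ ξ, Real.exp (-φ ξ)) ≤
      (∫ ξ, (u (∇ φ ξ) - symplecticPotential φ (∇ φ ξ)) * Real.exp (-φ ξ)) /
        ∫ ξ, Real.exp (-φ ξ) := by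
  set u₀ := symplecticPotential φ with hu₀def
  have hu₀ : u₀ ∈ P.convZero := h.symplecticPotential_mem_convZero
  have hleg : P.legendre u₀ = φ := h.legendre_symplecticPotential
  have hZ₀ : 0 < ∫ ξ, Real.exp (-φ ξ) := by
    have := integral_exp_neg_legendre_pos hu₀
    rwa [hleg] at this
  have hI₀ : Integrable fun ξ => Real.exp (-φ ξ) := by
    have := integrable_exp_neg_legendre hu₀
    rwa [hleg] at this
  have hZ := integral_exp_neg_legendre_pos hu
  set Z₀ := ∫ ξ, Real.exp (-φ ξ)
  set Z := ∫ ξ, Real.exp (-P.legendre u ξ)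
  set v : EuclideanSpace ℝ (Fin n) → ℝ := fun ξ => u (∇ φ ξ) - u₀ (∇ φ ξ) with hv
  have hvc : Continuous v := by
    have h1 : ∀ {w : EuclideanSpace ℝ (Fin n) → ℝ}, w ∈ P.convZero →
        Continuous fun ξ => w (∇ φ ξ) := fun hw =>
      hw.1.comp_continuous h.contDiff_gradient.continuous h.gradient_mem
    exact (h1 hu).sub (h1 hu₀)
  obtain ⟨M₁, hM₁⟩ := exists_bound_of_mem_convZero hu
  obtain ⟨M₂, hM₂⟩ := exists_bound_of_mem_convZero hu₀
  set M := M₁ + M₂ + 1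
  have hvM : ∀ ξ, |v ξ| ≤ M := fun ξ => by
    have h1 := hM₁ _ (h.gradient_mem ξ)
    have h2 := hM₂ _ (h.gradient_mem ξ)
    have h3 := abs_sub (u (∇ φ ξ)) (u₀ (∇ φ ξ))
    simp only [hv, M]
    linarith
  have hMpos : 0 < M := by
    have h1 := (abs_nonneg _).trans (hM₁ _ P.zero_mem_body)
    have h2 := (abs_nonneg _).trans (hM₂ _ P.zero_mem_body)
    simp only [M]
    linarith
  have hIv : Integrable fun ξ => v ξ * Real.exp (-φ ξ) :=
    hI₀.bdd_mul hvc.aestronglyMeasurable (Eventually.of_forall hvM)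
  set A := ∫ ξ, v ξ * Real.exp (-φ ξ)
  -- Compare the Prékopa–Leindler lower bound for `∫ e^{-φ_t}` with the upper bound that follows
  -- from `φ_t ≥ φ - t v` and `e^s ≤ 1 + s + s²` for `|s| ≤ 1`.
  have step : ∀ t, 0 < t → t < 1 → t * M ≤ 1 → Real.log Z - Real.log Z₀ ≤ A / Z₀ + t * M ^ 2 := by
    intro t ht0 ht1 htM
    set w : EuclideanSpace ℝ (Fin n) → ℝ := fun x => (1 - t) * u₀ x + t * u x with hw
    have hwmem : w ∈ P.convZero := add_smul_mem_convZero hu₀ hu ht0.le ht1.le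
    have hPL := integral_exp_neg_rpow_mul_le ht0 ht1 (continuous_legendre hu₀)
      (continuous_legendre hu) (continuous_legendre hwmem) (integrable_exp_neg_legendre hu₀)
      (integrable_exp_neg_legendre hu) (integrable_exp_neg_legendre hwmem) fun ξ η =>
        legendre_le fun x hx => by
          have h1 := mul_le_mul_of_nonneg_left (le_legendre hu₀ ξ hx) (by linarith : 0 ≤ 1 - t)
          have h2 := mul_le_mul_of_nonneg_left (le_legendre hu η hx) ht0.le
          rw [inner_add_right, inner_smul_right, inner_smul_right]
          simp only [hw]
          linarith
    rw [hleg] at hPL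
    have hup : ∫ ξ, Real.exp (-P.legendre w ξ) ≤ (1 + t ^ 2 * M ^ 2) * Z₀ + t * A := by
      rw [← integral_const_mul, ← integral_const_mul,
        ← integral_add (hI₀.const_mul _) (hIv.const_mul _)]
      refine integral_mono (integrable_exp_neg_legendre hwmem)
        ((hI₀.const_mul _).add (hIv.const_mul _)) fun ξ => ?_
      have h1 := le_legendre hwmem ξ (h.gradient_mem ξ)
      have h2 := h.symplecticPotential_gradient ξ
      rw [← hu₀def] at h2
      have h3 : -P.legendre w ξ ≤ t * v ξ + -φ ξ := by
        simp only [hw] at h1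
        simp only [hv]
        linarith
      have htv : |t * v ξ| ≤ t * M := by
        rw [abs_mul, abs_of_pos ht0]
        exact mul_le_mul_of_nonneg_left (hvM ξ) ht0.le
      have h4 := (abs_le.1 (Real.abs_exp_sub_one_sub_id_le (htv.trans htM))).2
      have h5 : (t * v ξ) ^ 2 ≤ t ^ 2 * M ^ 2 := by
        rw [← mul_pow]
        exact sq_le_sq' (abs_le.1 htv).1 (abs_le.1 htv).2
      calc Real.exp (-P.legendre w ξ) ≤ Real.exp (t * v ξ + -φ ξ) := Real.exp_le_exp.2 h3
        _ = Real.exp (t * v ξ) * Real.exp (-φ ξ) := Real.exp_add _ _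
        _ ≤ (1 + t ^ 2 * M ^ 2 + t * v ξ) * Real.exp (-φ ξ) :=
            mul_le_mul_of_nonneg_right (by linarith) (Real.exp_pos _).le
        _ = _ := by ring
    have hpos := mul_pos (Real.rpow_pos_of_pos hZ₀ (1 - t)) (Real.rpow_pos_of_pos hZ t)
    have hlog := Real.log_le_log hpos (hPL.trans hup)
    rw [Real.log_mul (Real.rpow_pos_of_pos hZ₀ _).ne' (Real.rpow_pos_of_pos hZ _).ne',
      Real.log_rpow hZ₀, Real.log_rpow hZ] at hlog
    have hB : 0 < (1 + t ^ 2 * M ^ 2) * Z₀ + t * A := hpos.trans_le (hPL.trans hup)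
    have hlog2 := Real.log_le_sub_one_of_pos (div_pos hB hZ₀)
    rw [Real.log_div hB.ne' hZ₀.ne'] at hlog2
    have h6 : ((1 + t ^ 2 * M ^ 2) * Z₀ + t * A) / Z₀ - 1 = t * (A / Z₀ + t * M ^ 2) := by
      field_simp
      ring
    rw [h6] at hlog2
    have h7 : t * (Real.log Z - Real.log Z₀) ≤ t * (A / Z₀ + t * M ^ 2) := by linarith
    exact le_of_mul_le_mul_left h7 ht0
  have hlim : Tendsto (fun t : ℝ => A / Z₀ + t * M ^ 2) (𝓝[>] 0) (𝓝 (A / Z₀)) := by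
    have : Continuous fun t : ℝ => A / Z₀ + t * M ^ 2 := by fun_prop
    exact (this.tendsto' 0 _ (by simp)).mono_left nhdsWithin_le_nhds
  refine ge_of_tendsto hlim ?_
  have h1 : ∀ᶠ t in 𝓝 (0 : ℝ), t < 1 ∧ t * M < 1 :=
    (eventually_lt_nhds zero_lt_one).and
      (((continuous_id.mul continuous_const).tendsto' 0 0 (by simp)).eventually_lt_const
        zero_lt_one)
  filter_upwards [h1.filter_mono nhdsWithin_le_nhds, self_mem_nhdsWithin] with t ht ht0
  exact step t ht0 ht.1 ht.2.le

end FanoPolytope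

/-! ### Integration over the toric manifold and over the polytope -/

/-- The real part pushes Lebesgue measure on the strip `-π < Im z ≤ π` to `2π` times Lebesgue
measure. -/
theorem map_re_volume_restrict_strip :
    (volume.restrict {z : ℂ | z.im ∈ Ioc (-Real.pi) Real.pi}).map Complex.re =
      ENNReal.ofReal (2 * Real.pi) • volume := by
  have h1 : MeasurePreserving Complex.measurableEquivRealProd
      (volume.restrict {z : ℂ | z.im ∈ Ioc (-Real.pi) Real.pi})
      (volume.prod (volume.restrict (Ioc (-Real.pi) Real.pi))) := by
    have := Complex.volume_preserving_equiv_real_prod.restrict_preimage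
      (s := univ ×ˢ Ioc (-Real.pi) Real.pi) (MeasurableSet.univ.prod measurableSet_Ioc)
    rw [Measure.volume_eq_prod, ← Measure.prod_restrict, Measure.restrict_univ] at this
    have hset : {z : ℂ | z.im ∈ Ioc (-Real.pi) Real.pi} =
        Complex.measurableEquivRealProd ⁻¹' (univ ×ˢ Ioc (-Real.pi) Real.pi) := by
      ext z
      simp
    rw [hset]
    exact this
  have h2 : Complex.re = Prod.fst ∘ Complex.measurableEquivRealProd := by
    ext z
    simp
  rw [h2, ← Measure.map_map measurable_fst Complex.measurableEquivRealProd.measurable, h1.map_eq,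
    Measure.map_fst_prod, Measure.restrict_apply_univ, Real.volume_Ioc]
  congr 2
  ring

theorem pi_const_smul_volume (n : ℕ) {c : ℝ≥0∞} (hc : c ≠ ⊤) :
    Measure.pi (fun _ : Fin n => c • (volume : Measure ℝ)) = c ^ n • volume := by
  lift c to ℝ≥0 using hc
  have : SigmaFinite ((c : ℝ≥0∞) • (volume : Measure ℝ)) :=
    inferInstanceAs (SigmaFinite (c • (volume : Measure ℝ)))
  refine Measure.pi_eq fun s _ => ?_
  rw [Measure.smul_apply, volume_pi, Measure.pi_pi]
  simp only [Measure.smul_apply, smul_eq_mul, Finset.prod_mul_distrib, Finset.prod_const,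
    Finset.card_univ, Fintype.card_fin]

/-- The real determinant of a complex homothety. -/
theorem det_smul_id_complex (a : ℂ) :
    (a • ContinuousLinearMap.id ℝ ℂ).det = Complex.normSq a := by
  have h := Algebra.norm_apply ℝ a
  rw [Algebra.norm_complex_eq] at h
  change _ = _ at h
  rw [ContinuousLinearMap.det]
  refine Eq.trans ?_ h.symm
  congr 1

/-- Integration over `ℂⁿ` in logarithmic coordinates, before the angles are integrated out. -/
theorem integral_eq_setIntegral_exp {n : ℕ} (K : (Fin n → ℂ) → ℝ) :
    ∫ y, K y = ∫ ζ in univ.pi fun _ : Fin n => {z : ℂ | z.im ∈ Ioc (-Real.pi) Real.pi},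
      Real.exp (∑ i, 2 * (ζ i).re) * K fun i => Complex.exp (ζ i) := by
  set S : Set (Fin n → ℂ) := univ.pi fun _ : Fin n => {z : ℂ | z.im ∈ Ioc (-Real.pi) Real.pi}
  have hS : MeasurableSet S :=
    MeasurableSet.univ_pi fun _ => Complex.measurable_im measurableSet_Ioc
  let E : (Fin n → ℂ) → (Fin n → ℂ) := fun ζ i => Complex.exp (ζ i)
  let E' : (Fin n → ℂ) → (Fin n → ℂ) →L[ℝ] (Fin n → ℂ) := fun ζ =>
    ContinuousLinearMap.pi fun k =>
      (Complex.exp (ζ k) • ContinuousLinearMap.id ℝ ℂ).comp (ContinuousLinearMap.proj k)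
  have hE' : ∀ ζ, HasFDerivAt E (E' ζ) ζ := fun ζ => hasFDerivAt_pi.2 fun k => by
    have h1 : HasFDerivAt (fun z : Fin n → ℂ => z k)
        (ContinuousLinearMap.proj k : (Fin n → ℂ) →L[ℝ] ℂ) ζ :=
      (ContinuousLinearMap.proj k : (Fin n → ℂ) →L[ℝ] ℂ).hasFDerivAt
    refine h1.cexp.congr_fderiv ?_
    ext w
    simp
  have hdet : ∀ ζ, |(E' ζ).det| = Real.exp (∑ i, 2 * (ζ i).re) := by
    intro ζ
    simp only [E']
    rw [ContinuousLinearMap.det_pi]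
    simp only [det_smul_id_complex, Complex.normSq_eq_norm_sq, Complex.norm_exp]
    rw [abs_of_nonneg (Finset.prod_nonneg fun i _ => by positivity), Real.exp_sum]
    refine Finset.prod_congr rfl fun i _ => ?_
    rw [← Real.exp_nat_mul]
    norm_num
  have hinj : InjOn E S := by
    intro ζ hζ ζ' hζ' h
    ext i
    exact Complex.exp_inj_of_neg_pi_lt_of_le_pi (hζ i (mem_univ i)).1 (hζ i (mem_univ i)).2
      (hζ' i (mem_univ i)).1 (hζ' i (mem_univ i)).2 (congrFun h i)
  have himage : ∀ᵐ y : Fin n → ℂ, y ∈ E '' S := by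
    have h1 : ∀ᵐ y : Fin n → ℂ, ∀ i, y i ≠ 0 :=
      ae_all_iff.2 fun i => Measure.ae_eval_ne (fun _ : Fin n => (volume : Measure ℂ)) i 0
    filter_upwards [h1] with y hy
    refine ⟨fun i => Complex.log (y i), fun i _ => ⟨Complex.neg_pi_lt_log_im _,
      Complex.log_im_le_pi _⟩, ?_⟩
    ext i
    exact Complex.exp_log (hy i)
  have h2 := integral_image_eq_integral_abs_det_fderiv_smul volume hS
    (fun ζ _ => (hE' ζ).hasFDerivWithinAt) hinj K
  rw [Measure.restrict_eq_self_of_ae_mem himage] at h2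
  rw [h2]
  refine setIntegral_congr_fun hS fun ζ _ => ?_
  simp only [hdet, smul_eq_mul, E]

namespace FanoPolytope

variable {n : ℕ} {P : FanoPolytope n}

/-- Integration of torus-invariant densities: in the variables `ξ_j = log |w_j|²` the angles
contribute a constant factor. -/
theorem Chart.exists_integral_eq (b : P.Chart) :
    ∃ c : ℝ, c ≠ 0 ∧ ∀ (K : (Fin n → ℂ) → ℝ) (F : EuclideanSpace ℝ (Fin n) → ℝ), Continuous F →
      (∀ ζ, Real.exp (∑ i, 2 * (ζ i).re) * K (fun i => Complex.exp (ζ i)) = F (b.logMap ζ)) →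
      ∫ y, K y = c * ∫ ξ, F ξ := by
  set S : Set (Fin n → ℂ) := univ.pi fun _ : Fin n => {z : ℂ | z.im ∈ Ioc (-Real.pi) Real.pi}
  set M : Matrix (Fin n) (Fin n) ℝ := (2 : ℝ) • (b.mat.map (Int.cast : ℤ → ℝ)).transpose
  have hM : M.det ≠ 0 := by
    have hd : (b.mat.map (Int.cast : ℤ → ℝ)).det = (b.mat.det : ℝ) := by
      have := (Int.castRingHom ℝ).map_det b.mat
      simpa using this.symm
    have h0 : b.mat.det ≠ 0 := fun h => by
      have := b.det_mat_sq
      rw [h] at this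
      norm_num at this
    simp only [M, Matrix.det_smul, Matrix.det_transpose, hd]
    exact mul_ne_zero (by positivity) (by exact_mod_cast h0)
  have hre : (volume.restrict S).map (fun ζ i => (ζ i).re) =
      ENNReal.ofReal (2 * Real.pi) ^ n • volume := by
    have : SigmaFinite ((volume.restrict {z : ℂ | z.im ∈ Ioc (-Real.pi) Real.pi}).map
        Complex.re) := by
      rw [map_re_volume_restrict_strip, ENNReal.ofReal]
      exact inferInstanceAs (SigmaFinite ((2 * Real.pi).toNNReal • (volume : Measure ℝ)))
    rw [volume_pi, Measure.restrict_pi_pi,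
      Measure.pi_map_pi (fun _ => Complex.measurable_re.aemeasurable)]
    simp only [map_re_volume_restrict_strip]
    rw [pi_const_smul_volume n ENNReal.ofReal_ne_top, volume_pi]
  have hL : ∀ ζ : Fin n → ℂ, b.logMap ζ =
      WithLp.toLp 2 (Matrix.toLin' M fun i => (ζ i).re) := by
    intro ζ
    ext k
    rw [Chart.logMap_apply, Chart.ofLogCoord_apply, Matrix.toLin'_apply]
    refine Finset.sum_congr rfl fun i _ => ?_
    simp [M]
    ring
  have e := PiLp.volume_preserving_toLp (Fin n)
  have hmeasLin : Measurable (Matrix.toLin' M) :=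
    (LinearMap.continuous_of_finiteDimensional _).measurable
  refine ⟨(ENNReal.ofReal (2 * Real.pi) ^ n).toReal * (ENNReal.ofReal |M.det⁻¹|).toReal,
    mul_ne_zero ?_ ?_, fun K F hF h => ?_⟩
  · rw [ENNReal.toReal_pow, ENNReal.toReal_ofReal (by positivity)]
    positivity
  · rw [ENNReal.toReal_ofReal (abs_nonneg _)]
    exact abs_ne_zero.2 (inv_ne_zero hM)
  rw [integral_eq_setIntegral_exp]
  simp only [h, hL]
  have hmeas : Measurable fun (ζ : Fin n → ℂ) (i : Fin n) => (ζ i).re := by fun_prop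
  have hcont : Continuous fun x : Fin n → ℝ => F (WithLp.toLp 2 (Matrix.toLin' M x)) :=
    hF.comp ((PiLp.continuous_toLp 2 _).comp (LinearMap.continuous_of_finiteDimensional _))
  calc ∫ ζ in S, F (WithLp.toLp 2 (Matrix.toLin' M fun i => (ζ i).re))
      = ∫ x, F (WithLp.toLp 2 (Matrix.toLin' M x))
          ∂((volume.restrict S).map fun ζ i => (ζ i).re) :=
        (integral_map hmeas.aemeasurable hcont.aestronglyMeasurable).symm
    _ = (ENNReal.ofReal (2 * Real.pi) ^ n).toReal *
          ∫ x, F (WithLp.toLp 2 (Matrix.toLin' M x)) := by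
        rw [hre, integral_smul_measure, smul_eq_mul]
    _ = (ENNReal.ofReal (2 * Real.pi) ^ n).toReal *
          ∫ x, F (WithLp.toLp 2 x) ∂((volume : Measure (Fin n → ℝ)).map (Matrix.toLin' M)) := by
        rw [integral_map (f := fun x => F (WithLp.toLp 2 x)) hmeasLin.aemeasurable
          (hF.comp (PiLp.continuous_toLp 2 _)).aestronglyMeasurable]
    _ = _ := by
        rw [Real.map_matrix_volume_pi_eq_smul_volume_pi hM, integral_smul_measure, smul_eq_mul,
          mul_assoc]
        congr 2
        exact e.integral_comp (MeasurableEquiv.toLp 2 _).measurableEmbedding F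

/-- The change of variables `x = ∇φ(ξ)` on the polytope. -/
theorem IsConvexPotential.setIntegral_body {φ : EuclideanSpace ℝ (Fin n) → ℝ}
    (h : P.IsConvexPotential φ) (F : EuclideanSpace ℝ (Fin n) → ℝ) :
    ∫ x in P.body, F x = ∫ ξ, |(hessian φ ξ).det| * F (∇ φ ξ) := by
  have h1 : (interior P.body : Set (EuclideanSpace ℝ (Fin n))) =ᵐ[volume] P.body :=
    interior_ae_eq_of_null_frontier (P.convex_body.addHaar_frontier volume)
  have h2 := integral_image_eq_integral_abs_det_fderiv_smul volume MeasurableSet.univ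
    (fun ξ _ => (h.hasStrictFDerivAt_gradient ξ).hasFDerivAt.hasFDerivWithinAt)
    h.injective_gradient.injOn F
  rw [image_univ, h.range_gradient, setIntegral_congr_set h1] at h2
  rw [h2, Measure.restrict_univ]
  simp only [IsConvexPotential.det_gradientDeriv, smul_eq_mul]

/-- The mean of `∇φ` with respect to `e^{-φ}` vanishes, since `e^{-φ} ∇φ` is a gradient. -/
theorem IsConvexPotential.integral_gradient {φ : EuclideanSpace ℝ (Fin n) → ℝ}
    (h : P.IsConvexPotential φ) (i : Fin n) : ∫ ξ, ∇ φ ξ i * Real.exp (-φ ξ) = 0 := by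
  have hI : Integrable fun ξ => Real.exp (-φ ξ) := by
    have := integrable_exp_neg_legendre h.symplecticPotential_mem_convZero
    rwa [h.legendre_symplecticPotential] at this
  obtain ⟨R, -, hR⟩ := P.exists_norm_le_body
  have hgi : Continuous fun ξ => ∇ φ ξ i :=
    (PiLp.continuous_apply 2 _ i).comp h.contDiff_gradient.continuous
  have hIg : Integrable fun ξ => ∇ φ ξ i * Real.exp (-φ ξ) :=
    hI.bdd_mul (c := R) hgi.aestronglyMeasurable (Eventually.of_forall fun ξ =>
      (PiLp.norm_apply_le _ i).trans (hR _ (h.gradient_mem ξ)))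
  have hd : ∀ ξ, HasFDerivAt (fun ξ => Real.exp (-φ ξ))
      (Real.exp (-φ ξ) • -fderiv ℝ φ ξ) ξ := fun ξ => (h.hasFDerivAt ξ).neg.exp
  have hval : ∀ ξ, fderiv ℝ (fun ξ => Real.exp (-φ ξ)) ξ (EuclideanSpace.single i 1) =
      -(∇ φ ξ i * Real.exp (-φ ξ)) := by
    intro ξ
    have h1 := inner_gradient_eq_fderiv φ ξ (EuclideanSpace.single i 1)
    rw [EuclideanSpace.inner_single_right] at h1
    simp only [conj_trivial, one_mul] at h1
    rw [(hd ξ).fderiv, _root_.smul_apply, _root_.neg_apply, ← h1, smul_eq_mul]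
    ring
  have key := integral_mul_fderiv_eq_neg_fderiv_mul_of_integrable (μ := volume) (𝕜 := ℝ)
    (f := fun _ : EuclideanSpace ℝ (Fin n) => (1 : ℝ)) (g := fun ξ => Real.exp (-φ ξ))
    (v := EuclideanSpace.single i 1) (by simp) (by simpa [hval] using hIg.neg) (by simpa using hI)
    (fun _ _ => differentiableAt_const _) (fun ξ _ => (hd ξ).differentiableAt)
  simpa [hval, integral_neg] using key

end FanoPolytope

/-! ### Balancing and minimization -/

namespace FanoPolytope

variable {n : ℕ} {P : FanoPolytope n}

theorem IsConvexPotential.integrable_comp_gradient_mul {φ u : EuclideanSpace ℝ (Fin n) → ℝ}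
    (h : P.IsConvexPotential φ) (hu : u ∈ P.convZero) :
    Integrable fun ξ => u (∇ φ ξ) * Real.exp (-φ ξ) := by
  have hI : Integrable fun ξ => Real.exp (-φ ξ) := by
    have := integrable_exp_neg_legendre h.symplecticPotential_mem_convZero
    rwa [h.legendre_symplecticPotential] at this
  obtain ⟨M, hM⟩ := exists_bound_of_mem_convZero hu
  exact hI.bdd_mul (c := M)
    (hu.1.comp_continuous h.contDiff_gradient.continuous h.gradient_mem).aestronglyMeasurable
    (Eventually.of_forall fun ξ => hM _ (h.gradient_mem ξ))

theorem transported_eq (ρ : P.X → ℝ) (u : EuclideanSpace ℝ (Fin n) → ℝ)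
    (x : EuclideanSpace ℝ (Fin n)) : P.transported ρ u x = Real.exp (orbitFun ρ (∇ u x)) := rfl

theorem measurable_transported {ρ : P.X → ℝ} (hρ : P.SmoothFunction ρ)
    (u : EuclideanSpace ℝ (Fin n) → ℝ) : Measurable (P.transported ρ u) := by
  have h : Measurable (∇ u) :=
    (InnerProductSpace.toDual ℝ (EuclideanSpace ℝ (Fin n))).symm.continuous.measurable.comp
      (measurable_fderiv ℝ u)
  exact ((Real.continuous_exp.comp (contDiff_orbitFun hρ).continuous).measurable).comp h

namespace InvariantKahlerMetric

variable {g : P.InvariantKahlerMetric} {φ : EuclideanSpace ℝ (Fin n) → ℝ} {ρ : P.X → ℝ}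

theorem isConvexPotential (hρ : g.IsNormalizedRicciPotential ρ) (hφ : g.IsPotential φ) :
    P.IsConvexPotential φ where
  smooth := hφ.1
  hessian_pos ξ _ hv := hessian_pos hφ ξ hv
  gradient_mem := hφ.2.2
  growth := exists_inner_sub_potential_le hρ hφ

/-- The map `∇φ` sends a constant multiple of `e^{-φ} dξ` to `σ dx`: this is the Monge–Ampère
equation. -/
theorem exists_setIntegral_mul_transported (hρ : g.IsNormalizedRicciPotential ρ)
    (hφ : g.IsPotential φ) :
    ∃ d : ℝ, ∀ f : EuclideanSpace ℝ (Fin n) → ℝ,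
      ∫ x in P.body, f x * P.transported ρ (symplecticPotential φ) x =
        Real.exp d * ∫ ξ, f (∇ φ ξ) * Real.exp (-φ ξ) := by
  have h := isConvexPotential hρ hφ
  obtain ⟨d, hd⟩ := exists_monge_ampere hρ hφ
  refine ⟨d, fun f => ?_⟩
  rw [h.setIntegral_body, ← integral_const_mul]
  congr 1
  ext ξ
  have hpos := det_hessian_pos hφ ξ
  have hdet : (hessian φ ξ).det * Real.exp (orbitFun ρ ξ) = Real.exp d * Real.exp (-φ ξ) := by
    rw [← Real.exp_log hpos, ← Real.exp_add, ← Real.exp_add]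
    congr 1
    linarith [hd ξ]
  rw [transported_eq, h.gradient_symplecticPotential, abs_of_pos hpos]
  linear_combination f (∇ φ ξ) * hdet

/-- The normalization `∫_X e^ρ ωⁿ = ∫_X ωⁿ`, carried over to the polytope by the moment map. -/
theorem setIntegral_transported (hρ : g.IsNormalizedRicciPotential ρ) (hφ : g.IsPotential φ) :
    ∫ x in P.body, P.transported ρ (symplecticPotential φ) x = P.vol := by
  have h := isConvexPotential hρ hφ
  obtain ⟨b⟩ := P.chart_nonempty
  obtain ⟨c, hc, hint⟩ := b.exists_integral_eq
  obtain ⟨d, hd⟩ := exists_monge_ampere hρ hφ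
  have hdet : ∀ ξ, (hessian φ ξ).det = Real.exp (d - φ ξ - orbitFun ρ ξ) := by
    intro ξ
    rw [← hd ξ]
    ring_nf
    rw [Real.exp_log (det_hessian_pos hφ ξ)]
  have hdc : Continuous fun ξ => (hessian φ ξ).det := by
    simp only [hdet]
    exact Real.continuous_exp.comp
      ((continuous_const.sub h.smooth.continuous).sub (contDiff_orbitFun hρ.1).continuous)
  have hρc : Continuous fun ξ => Real.exp (orbitFun ρ ξ) :=
    Real.continuous_exp.comp (contDiff_orbitFun hρ.1).continuous
  set k : ℝ := (n.factorial : ℝ) * 2 ^ n with hk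
  have hk0 : k ≠ 0 := by positivity
  have e1 := hint (fun y => Real.exp (ρ (b.point y)) * (k * (g.coeff b y).det.re))
    (fun ξ => k * (Real.exp (orbitFun ρ ξ) * (hessian φ ξ).det))
    (continuous_const.mul (hρc.mul hdc)) fun ζ => by
      rw [ricciPotential_exp hρ hφ, det_coeff_exp hφ]
      ring
  have e2 := hint (fun y => 1 * (k * (g.coeff b y).det.re))
    (fun ξ => k * (hessian φ ξ).det) (continuous_const.mul hdc) fun ζ => by
      rw [det_coeff_exp hφ]
      ring
  have e3 : c * ∫ ξ, k * (Real.exp (orbitFun ρ ξ) * (hessian φ ξ).det) =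
      c * ∫ ξ, k * (hessian φ ξ).det := by
    rw [← e1, ← e2]
    exact hρ.2.2 b
  rw [integral_const_mul, integral_const_mul] at e3
  have e4 := mul_left_cancel₀ hk0 (mul_left_cancel₀ hc e3)
  rw [vol, h.setIntegral_body, h.setIntegral_body]
  simp only [transported_eq, h.gradient_symplecticPotential, mul_one]
  simp only [abs_of_pos (det_hessian_pos hφ _)]
  rw [← e4]
  congr 1
  ext ξ
  ring

theorem isBalancing_transported (hρ : g.IsNormalizedRicciPotential ρ) (hφ : g.IsPotential φ) :
    P.IsBalancing (P.transported ρ (symplecticPotential φ)) := by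
  obtain ⟨C, hC⟩ := exists_bound_orbitFun hρ.1
  refine ⟨?_, Eventually.of_forall fun x => (Real.exp_pos _).le, setIntegral_transported hρ hφ,
    fun i => ?_⟩
  · have : IsFiniteMeasure (volume.restrict P.body) :=
      ⟨by rw [Measure.restrict_apply_univ]; exact P.isCompact_body.measure_lt_top⟩
    refine MemLp.of_bound (measurable_transported hρ.1 _).aestronglyMeasurable (Real.exp C)
      (Eventually.of_forall fun x => ?_)
    rw [transported_eq, Real.norm_of_nonneg (Real.exp_pos _).le]
    exact Real.exp_le_exp.2 (abs_le.1 (hC _)).2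
  · obtain ⟨d, hd⟩ := exists_setIntegral_mul_transported hρ hφ
    have := hd fun x => x i
    rw [(isConvexPotential hρ hφ).integral_gradient, mul_zero] at this
    simpa only [mul_comm] using this

/-- The symplectic potential minimizes the Ding functional twisted by the transported Ricci
potential. -/
theorem ding_symplecticPotential_le (hρ : g.IsNormalizedRicciPotential ρ) (hφ : g.IsPotential φ)
    {u : EuclideanSpace ℝ (Fin n) → ℝ} (hu : u ∈ P.convZero) :
    P.ding (P.transported ρ (symplecticPotential φ)) (symplecticPotential φ) ≤
      P.ding (P.transported ρ (symplecticPotential φ)) u := by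
  have h := isConvexPotential hρ hφ
  have hu₀ := h.symplecticPotential_mem_convZero
  obtain ⟨d, hd⟩ := exists_setIntegral_mul_transported hρ hφ
  have hV : P.vol = Real.exp d * ∫ ξ, Real.exp (-φ ξ) := by
    rw [← setIntegral_transported hρ hφ]
    simpa using hd fun _ => 1
  have hZ : 0 < ∫ ξ, Real.exp (-φ ξ) := by
    have := integral_exp_neg_legendre_pos hu₀
    rwa [h.legendre_symplecticPotential] at this
  have key := h.log_integral_le hu
  simp only [sub_mul] at key
  rw [integral_sub (h.integrable_comp_gradient_mul hu) (h.integrable_comp_gradient_mul hu₀)] at key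
  rw [ding_eq hu, ding_eq hu₀, h.legendre_symplecticPotential, hd, hd, hV]
  set Z := ∫ ξ, Real.exp (-φ ξ)
  have hscale : ∀ A : ℝ, 1 / (Real.exp d * Z) * (Real.exp d * A) = A / Z := fun A => by
    field_simp
  rw [hscale, hscale]
  rw [sub_div] at key
  linarith

end InvariantKahlerMetric

end FanoPolytope

end

theorem mainTheorem8 (n : ℕ) (P : FanoPolytope n) (ω₀ : P.InvariantKahlerMetric)
    (ρ₀ : P.X → ℝ) (hρ₀ : ω₀.IsNormalizedRicciPotential ρ₀)
    (φ₀ : EuclideanSpace ℝ (Fin n) → ℝ) (hφ₀ : ω₀.IsPotential φ₀)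
    (u₀ : EuclideanSpace ℝ (Fin n) → ℝ) (hu₀ : u₀ = symplecticPotential φ₀)
    (σ₀ : EuclideanSpace ℝ (Fin n) → ℝ) (hσ₀ : σ₀ = P.transported ρ₀ u₀) :
    (P.IsBalancing σ₀ ∧ ∃ ε > 0, ∀ x ∈ interior P.body, ε ≤ σ₀ x) ∧
    (u₀ ∈ P.convZero ∧
      ∀ u ∈ P.convZero,
        MeasureTheory.Integrable (P.dingDensity u) ∧ P.ding σ₀ u₀ ≤ P.ding σ₀ u) := by
  subst hu₀ hσ₀
  obtain ⟨C, hC⟩ := FanoPolytope.exists_bound_orbitFun hρ₀.1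
  exact ⟨⟨FanoPolytope.InvariantKahlerMetric.isBalancing_transported hρ₀ hφ₀, Real.exp (-C),
      Real.exp_pos _, fun x _ => Real.exp_le_exp.2 (abs_le.1 (hC _)).1⟩,
    (FanoPolytope.InvariantKahlerMetric.isConvexPotential
      hρ₀ hφ₀).symplecticPotential_mem_convZero,
    fun u hu => ⟨FanoPolytope.integrable_dingDensity hu,
      FanoPolytope.InvariantKahlerMetric.ding_symplecticPotential_le hρ₀ hφ₀ hu⟩⟩
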